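/- All trees are finite, nonempty, rooted and unordered. The degree of a node is its number of children, the depth of a node is its number of proper ancestors, a leaf is a node of degree $0$, an inner node is a node that is not a leaf, and a tree is binary if all degrees are at most $2$. Let $\mathcal{B}_n$ be the class of binary trees with exactly $n$ leaves and no node of degree $1$. An injective map $f$ from the nodes of $T'$ to the nodes of $T$ preserves the NCA relationship if $f(\mathrm{NCA}(u,v))=\mathrm{NCA}(f(u),f(v))$ for all nodes $u,v$ of $T'$. A tree $T$ is a *parity-preserving minor-universal tree* for a class $\mathcal{T}$ if for every $T'\in\mathcal{T}$ there is such a map $T'\to T$ for which $v$ and $f(v)$ have depths of the same parity, for every node $v$ of $T'$. A tree $T$ is a *parity-constrained minor-universal tree* for $\mathcal{T}$ if for every $T'\in\mathcal{T}$ and every assignment $c$ of values in $\{0,1\}$ to the inner nodes of $T'$ there is such a map $T'\to T$ for which the depth of $f(v)$ is congruent to $c(v)$ modulo $2$, for every inner node $v$ of $T'$. *Cutting* a tree means selecting a node $a$ that is a child of some node, and removing the entire subtree rooted at $a$. *Contracting* means selecting an inner node $b$ that has a parent $a$ and a single child $c$, and removing $b$; if $c$ is an inner node, then $c$ is removed as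 well and the children of $c$ become children of $a$; if $c$ is a leaf, it becomes a child of $a$. A tree $T$ *implements* $T'$ if $T'$ can be obtained (up to isomorphism) from $T$ by a finite sequence of cuttings and contractions. A tree is *$n$-universal in the sense of Young et al.* if it implements every tree, of arbitrary degrees, that has at most $n$ leaves and no node of degree $1$. Let $b(n)$ be the minimum number of leaves of a parity-constrained minor-universal tree for $\mathcal{B}_n$. Then: 1. For every $n$, every $n$-universal tree is a parity-preserving minor-universal tree for $\mathcal{B}_n$. 2. For every $n\ge 1$, every $(2n-1)$-universal tree is a parity-constrained minor-universal tree for $\mathcal{B}_n$. 3. For every $n\ge 1$, $b(n)\ \ge\ 1+2\sum_{2\le s\le n} b(\lfloor n/s\rfloor)$. 4. For every real $c>1$ with $\zeta(c)>1.5$ we have $b(n)=\Omega(n^{c})$. Moreover $\zeta(2.185)>1.5$, and hence $b(n)=\Omega(n^{2.185})$. 5. There is a constant $a>0$ such that for all sufficiently large $n$ every $n$-universal tree has at least $a\,n^{2.185}$ leaves, and hence at least $a\,n^{2.185}$ nodes. -/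

import Mathlib

open Filter Asymptotics

/-! Rooted (unordered) trees are Mathlib's `RootedTree`: the order is the ancestor order, the root
is `⊥`, `u ⋖ v` says that `v` is a child of `u`, and `u ⊓ v` is the nearest common ancestor. -/

namespace RootedTree

/-- The depth of a node: the number of its proper ancestors. -/
noncomputable def depth (T : RootedTree) (v : T) : ℕ := (Set.Iio v).ncard

/-- The degree of a node: the number of its children. -/
noncomputable def degree (T : RootedTree) (v : T) : ℕ := {w : T | v ⋖ w}.ncard

/-- A leaf is a node without children. -/
def IsLeaf (T : RootedTree) (v : T) : Prop := ∀ w : T, ¬ v ⋖ w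

/-- The number of leaves of a (finite) tree. -/
noncomputable def numLeaves (T : RootedTree) : ℕ := {v : T | T.IsLeaf v}.ncard

/-- The set of inner nodes, i.e. nodes that are not leaves. -/
def inner (T : RootedTree) : Set T := {v | ¬ T.IsLeaf v}

/-- No node has exactly one child. -/
def NoDegreeOne (T : RootedTree) : Prop := ∀ v : T, T.degree v ≠ 1

/-- Every node has at most two children. -/
def IsBinary (T : RootedTree) : Prop := ∀ v : T, T.degree v ≤ 2

/-- The class of finite binary trees with exactly `n` leaves and no node of degree one. -/
def binaryTrees (n : ℕ) : Set RootedTree.{0} :=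
  {T | Finite T ∧ T.IsBinary ∧ T.NoDegreeOne ∧ T.numLeaves = n}

/-- An (injective) map of nodes that preserves nearest common ancestors; it exhibits `S` as a
topological minor of `T`. -/
def PreservesNCA {S T : RootedTree} (f : S → T) : Prop :=
  Function.Injective f ∧ ∀ u v : S, f (u ⊓ v) = f u ⊓ f v

/-- `T` is a parity-preserving minor-universal tree for the class `C`. -/
def IsParityPreservingUniversal (T : RootedTree.{0}) (C : Set RootedTree.{0}) : Prop :=
  ∀ S ∈ C, ∃ f : S → T, PreservesNCA f ∧ ∀ v : S, T.depth (f v) % 2 = S.depth v % 2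

/-- `T` is a parity-constrained minor-universal tree for the class `C`: every tree of `C` with
every parity constraint `c` on its inner nodes can be mapped to `T`. -/
def IsParityConstrainedUniversal (T : RootedTree.{0}) (C : Set RootedTree.{0}) : Prop :=
  ∀ S ∈ C, ∀ c : S.inner → Fin 2,
    ∃ f : S → T, PreservesNCA f ∧ ∀ v : S.inner, T.depth (f v) % 2 = (c v : ℕ)

/-- `S` arises from `T` by cutting: the entire subtree rooted at a child `a` of some node `b` is
removed. -/
def Cutting (T S : RootedTree.{0}) : Prop :=
  ∃ a b : T, b ⋖ a ∧ Nonempty (S ≃o {x : T // ¬ a ≤ x})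

/-- `S` arises from `T` by contraction at a node `b` with parent `a` and a single child `c`.
If `c` is an inner node, then `b` and `c` are removed, and in the induced ancestor order the
children of `c` become children of `a`; if `c` is a leaf, then only `b` is removed, and `c`
becomes a child of `a`. -/
def Contraction (T S : RootedTree.{0}) : Prop :=
  ∃ a b c : T, a ⋖ b ∧ (∀ x : T, b ⋖ x ↔ x = c) ∧
    ((¬ T.IsLeaf c ∧ Nonempty (S ≃o {x : T // x ≠ b ∧ x ≠ c})) ∨
      (T.IsLeaf c ∧ Nonempty (S ≃o {x : T // x ≠ b})))

/-- `T` implements `S`: up to isomorphism, `S` is obtained from `T` by a finite (possibly empty)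
sequence of cutting and contraction operations. -/
def Implements (T S : RootedTree.{0}) : Prop :=
  ∃ S' : RootedTree.{0},
    Relation.ReflTransGen (fun X Y => Cutting X Y ∨ Contraction X Y) T S' ∧ Nonempty (S' ≃o S)

/-- `T` is an `n`-universal tree in the sense of Young et al.: it implements every finite tree
(with no bound on the degrees) with at most `n` leaves and no node of degree one. -/
def IsYoungUniversal (n : ℕ) (T : RootedTree.{0}) : Prop :=
  ∀ S : RootedTree.{0}, Finite S → S.NoDegreeOne → S.numLeaves ≤ n → Implements T S

/-- `b(n)`: the smallest number of leaves of a finite parity-constrained minor-universal tree for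
binary trees with `n` leaves and no node of degree one. -/
noncomputable def minLeaves (n : ℕ) : ℕ :=
  sInf {k | ∃ T : RootedTree.{0},
    Finite T ∧ T.IsParityConstrainedUniversal (binaryTrees n) ∧ T.numLeaves = k}

end RootedTree

/-! Both operations of Young et al. respect parities for binary trees: an NCA-preserving map from a
binary tree into the result of one operation lifts to the tree before it. A cutting leaves a lower
set, so nothing changes. A contraction deletes two consecutive levels or moves a leaf up by one, and
both effects can be undone by moving a single image. This is `Implements.exists_preservesNCA`.

A new leaf grafted above a node shifts the depth of its whole subtree by one. Correcting wrong
parities from the root downwards costs at most one leaf per inner node, hence at most n - 1 leaves,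
which explains 2n - 1 in `IsYoungUniversal.isParityConstrainedUniversal`.

For the recursion, let T be parity-constrained universal for n leaves. For s ≥ 2 and a parity p,
consider the nodes of T from which a path with s - 1 branching nodes of parity p descends. They form
a subtree containing the root, and it is universal for ⌊n/s⌋ leaves: replace every leaf of a given
tree by a caterpillar with s leaves whose inner nodes are constrained to parity p. So this subtree
has at least b(⌊n/s⌋) leaves. Each of these leaves is a branching node of T that determines both p
and s, so different pairs (s, p) yield different nodes. As T has more leaves than branching nodes
(`ncard_branching_lt`), summing over s and p gives `one_add_two_mul_sum_le_minLeaves`.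

The ansatz ε(n+1)^c survives this recursion as soon as twice the sum of s^(-c) over 2 ≤ s ≤ n is at
least 1, which holds for large n if ζ(c) > 3/2. The value at 2.185 is certified by twelve terms and
a trapezoidal bound for the tail. -/

namespace RootedTree

/-! ### Order-theoretic facts about finite rooted trees -/

/-- A node is branching if it is the nearest common ancestor of two of its proper descendants. -/
def Branching (T : RootedTree) (v : T) : Prop := ∃ x y : T, v < x ∧ v < y ∧ x ⊓ y = v

theorem le_total_of_le {T : RootedTree} {a b c : T} (ha : a ≤ c) (hb : b ≤ c) : a ≤ b ∨ b ≤ a :=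
  (le_total_of_directed ha hb).symm

theorem isLeaf_iff {T : RootedTree} [Finite T] {v : T} : T.IsLeaf v ↔ ∀ w, v ≤ w → w = v := by
  constructor
  · intro h w hw
    by_contra hne
    obtain ⟨x, hx, -⟩ := exists_covBy_le_of_lt (lt_of_le_of_ne hw (Ne.symm hne))
    exact h x hx
  · intro h w hw
    exact hw.lt.ne' (h w hw.le)

theorem mem_inner_iff {T : RootedTree} [Finite T] {v : T} : v ∈ T.inner ↔ ∃ w, v < w := by
  simp only [inner, Set.mem_ofPred_eq, isLeaf_iff, not_forall]
  constructor
  · rintro ⟨w, hw, hne⟩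
    exact ⟨w, lt_of_le_of_ne hw (Ne.symm hne)⟩
  · rintro ⟨w, hw⟩
    exact ⟨w, hw.le, hw.ne'⟩

theorem Branching.mem_inner {T : RootedTree} [Finite T] {v : T} (h : T.Branching v) :
    v ∈ T.inner := by
  obtain ⟨x, -, hx, -⟩ := h
  exact mem_inner_iff.2 ⟨x, hx⟩

theorem eq_of_covBy_of_le {T : RootedTree} {v x y z : T} (hx : v ⋖ x) (hy : v ⋖ y)
    (hxz : x ≤ z) (hyz : y ≤ z) : x = y := by
  rcases le_total_of_le hxz hyz with h | h
  · exact (eq_of_le_of_not_lt h fun h' => hy.2 hx.lt h')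
  · exact (eq_of_le_of_not_lt h fun h' => hx.2 hy.lt h').symm

/-- If the infimum were strictly above `v`, it would lie in the subtree of one child of `v`, and
that child would coincide with both `x` and `y`. -/
theorem inf_eq_of_covBy {T : RootedTree} [Finite T] {v x y x' y' : T} (hx : v ⋖ x) (hy : v ⋖ y)
    (hne : x ≠ y) (hxx : x ≤ x') (hyy : y ≤ y') : x' ⊓ y' = v := by
  refine le_antisymm ?_ (le_inf (hx.le.trans hxx) (hy.le.trans hyy))
  rcases lt_or_le_of_directed (inf_le_left : x' ⊓ y' ≤ x') (hx.le.trans hxx) with h | h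
  · exact h.le
  rcases h.eq_or_lt with h | h
  · exact h.ge
  exfalso
  obtain ⟨z, hz, hzle⟩ := exists_covBy_le_of_lt h
  exact hne ((eq_of_covBy_of_le hx hz hxx (hzle.trans inf_le_left)).trans
    (eq_of_covBy_of_le hz hy (hzle.trans inf_le_right) hyy))

theorem exists_covBy_of_branching {T : RootedTree} [Finite T] {v : T} (h : T.Branching v) :
    ∃ x y, v ⋖ x ∧ v ⋖ y ∧ x ≠ y := by
  obtain ⟨x, y, hx, hy, hxy⟩ := h
  obtain ⟨x', hx', hxx⟩ := exists_covBy_le_of_lt hx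
  obtain ⟨y', hy', hyy⟩ := exists_covBy_le_of_lt hy
  refine ⟨x', y', hx', hy', ?_⟩
  rintro rfl
  exact hx'.lt.not_ge (hxy ▸ le_inf hxx hyy)

theorem Branching.two_le_degree {T : RootedTree} [Finite T] {v : T} (h : T.Branching v) :
    2 ≤ T.degree v := by
  obtain ⟨x, y, hx, hy, hne⟩ := exists_covBy_of_branching h
  exact (Set.one_lt_ncard (Set.toFinite _)).2 ⟨x, hx, y, hy, hne⟩

theorem one_le_degree {T : RootedTree} [Finite T] {v : T} (h : v ∈ T.inner) :
    1 ≤ T.degree v := by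
  simp only [inner, IsLeaf, Set.mem_ofPred_eq, not_forall, not_not] at h
  exact (Set.ncard_pos (Set.toFinite _)).2 h

theorem NoDegreeOne.branching {T : RootedTree} [Finite T] (hT : T.NoDegreeOne) {v : T}
    (h : v ∈ T.inner) : T.Branching v := by
  have h2 : 1 < T.degree v := lt_of_le_of_ne (one_le_degree h) (hT v).symm
  obtain ⟨x, hx, y, hy, hne⟩ := (Set.one_lt_ncard (Set.toFinite _)).1 h2
  exact ⟨x, y, CovBy.lt hx, CovBy.lt hy, inf_eq_of_covBy hx hy hne le_rfl le_rfl⟩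

/-- Double counting of edges: every node except the root is the child of exactly one node, its
`Order.pred`. -/
theorem sum_degree_add_one (T : RootedTree) [Fintype T] :
    ∑ v : T, T.degree v + 1 = Fintype.card T := by
  classical
  have h : ∀ v : T, T.degree v =
      (((Finset.univ.erase ⊥ : Finset T)).filter fun w => Order.pred w = v).card := by
    intro v
    rw [degree, ← Set.ncard_coe_finset]
    congr 1
    ext w
    simp only [Set.mem_ofPred_eq, Finset.coe_filter, Finset.mem_erase, Finset.mem_univ, and_true]
    constructor
    · exact fun hw => ⟨(bot_le.trans_lt hw.lt).ne', hw.pred_eq⟩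
    · rintro ⟨hw, rfl⟩
      exact Order.pred_covBy_of_not_isMin fun hm => hw hm.eq_bot
  simp_rw [h]
  rw [← Finset.card_eq_sum_card_fiberwise (f := Order.pred) (s := Finset.univ.erase (⊥ : T))
      (t := Finset.univ) (fun _ _ => Finset.mem_coe.2 (Finset.mem_univ _)),
    Finset.card_erase_add_one (Finset.mem_univ _), Finset.card_univ]

theorem numLeaves_add_ncard_inner (T : RootedTree) [Finite T] :
    T.numLeaves + T.inner.ncard = Nat.card T :=
  Set.ncard_add_ncard_compl {v : T | T.IsLeaf v}

/-- A finite tree has more leaves than branching nodes. -/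
theorem ncard_branching_lt (T : RootedTree) [Finite T] :
    {v | T.Branching v}.ncard + 1 ≤ T.numLeaves := by
  classical
  have := Fintype.ofFinite T
  have h1 := sum_degree_add_one T
  have h2 := numLeaves_add_ncard_inner T
  rw [Nat.card_eq_fintype_card] at h2
  -- An inner node contributes at least one child and a branching node at least two; comparing with
  -- the edge count leaves the surplus of leaves.
  have h3 : T.inner.ncard + {v | T.Branching v}.ncard ≤ ∑ v : T, T.degree v := by
    have hc : ∀ s : Set T, s.ncard = ∑ v : T, if v ∈ s then 1 else 0 := by
      intro s
      rw [Set.ncard_eq_toFinset_card', ← Finset.card_filter]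
      congr 1
      ext
      simp
    rw [hc, hc, ← Finset.sum_add_distrib]
    refine Finset.sum_le_sum fun v _ => ?_
    by_cases hb : T.Branching v
    · have := hb.two_le_degree
      simp only [Set.mem_ofPred_eq, hb, hb.mem_inner, if_true]
      omega
    · simp only [Set.mem_ofPred_eq, hb, if_false]
      split_ifs with hi
      · exact one_le_degree hi
      · exact Nat.zero_le _
  omega

/-! ### Constructing finite rooted trees -/

theorem exists_isGreatest_of_chain {α : Type*} [PartialOrder α] [Finite α] {s : Set α}
    (hne : s.Nonempty) (hs : ∀ a ∈ s, ∀ b ∈ s, a ≤ b ∨ b ≤ a) : ∃ m, IsGreatest s m := by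
  obtain ⟨m, hm⟩ := s.toFinite.exists_maximal hne
  exact ⟨m, hm.prop, fun b hb => (hs b hb m hm.prop).elim id fun h => hm.le_of_ge hb h⟩

/-- The rooted tree of a finite order with a least element in which the elements below any given
one form a chain. -/
noncomputable def ofFinite (α : Type) [P : PartialOrder α] [B : OrderBot α] [Finite α]
    (h : ∀ a b c : α, a ≤ c → b ≤ c → a ≤ b ∨ b ≤ a) : RootedTree.{0} :=
  have hinf : ∀ a b : α, ∃ m, IsGreatest {x | x ≤ a ∧ x ≤ b} m := fun a b =>
    exists_isGreatest_of_chain ⟨⊥, bot_le, bot_le⟩ fun x hx y hy => h x y a hx.1 hy.1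
  have hpred : ∀ a : α, ∃ m, m ≤ a ∧ (a ≤ m → IsMin a) ∧ ∀ b, b < a → b ≤ m := fun a => by
    by_cases ha : (Set.Iio a).Nonempty
    · obtain ⟨m, hm⟩ := exists_isGreatest_of_chain ha fun x hx y hy =>
        h x y a (le_of_lt hx) (le_of_lt hy)
      exact ⟨m, le_of_lt hm.1, fun h' => absurd hm.1 h'.not_gt, fun b hb => hm.2 hb⟩
    -- With nothing strictly below it, `a` is the root and serves as its own predecessor.
    · exact ⟨a, le_rfl, fun _ b hb => le_of_eq (by
        by_contra hne
        exact ha ⟨b, lt_of_le_of_ne hb (Ne.symm hne)⟩), fun b hb => hb.le⟩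
  letI : SemilatticeInf α :=
    { P with
      inf := fun a b => (hinf a b).choose
      inf_le_left := fun a b => (hinf a b).choose_spec.1.1
      inf_le_right := fun a b => (hinf a b).choose_spec.1.2
      le_inf := fun a b c hab hac => (hinf b c).choose_spec.2 ⟨hab, hac⟩ }
  letI : PredOrder α :=
    { pred := fun a => (hpred a).choose
      pred_le := fun a => (hpred a).choose_spec.1
      min_of_le_pred := fun {a} ha => (hpred a).choose_spec.2.1 ha
      le_pred_of_lt := fun {a b} hab => (hpred b).choose_spec.2.2 a hab }
  { α := α
    orderBot := B }

/-- An injective monotone map whose restriction to each principal lower set is onto a principal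
lower set preserves nearest common ancestors and depths. -/
theorem preservesNCA_of_lower {S T : RootedTree.{0}} {f : S → T} (hinj : Function.Injective f)
    (hmono : ∀ u v, u ≤ v → f u ≤ f v) (hlow : ∀ u l, l ≤ f u → ∃ w ≤ u, f w = l) :
    PreservesNCA f ∧ ∀ v, T.depth (f v) = S.depth v := by
  refine ⟨⟨hinj, fun u v => le_antisymm ?_ ?_⟩, fun v => ?_⟩
  · exact le_inf (hmono _ _ inf_le_left) (hmono _ _ inf_le_right)
  · obtain ⟨w, hw, hw'⟩ := hlow u (f u ⊓ f v) inf_le_left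
    obtain ⟨w₂, hw₂, hw₂'⟩ := hlow v (f u ⊓ f v) inf_le_right
    obtain rfl := hinj (hw'.trans hw₂'.symm)
    rw [← hw']
    exact hmono _ _ (le_inf hw hw₂)
  · have : Set.Iio (f v) = f '' Set.Iio v := by
      ext l
      constructor
      · intro hl
        obtain ⟨w, hw, rfl⟩ := hlow v l (le_of_lt hl)
        exact ⟨w, lt_of_le_of_ne hw (by rintro rfl; exact lt_irrefl _ hl), rfl⟩
      · rintro ⟨w, hw, rfl⟩
        exact lt_of_le_of_ne (hmono _ _ (le_of_lt hw)) fun h => (hinj h).not_lt hw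
    rw [depth, this, Set.ncard_image_of_injective _ hinj, depth]

/-! ### Maps that preserve nearest common ancestors -/

theorem PreservesNCA.le_iff {S T : RootedTree} {f : S → T} (hf : PreservesNCA f) {u v : S} :
    f u ≤ f v ↔ u ≤ v := by
  rw [← inf_eq_left, ← hf.2, hf.1.eq_iff, inf_eq_left]

theorem PreservesNCA.lt_iff {S T : RootedTree} {f : S → T} (hf : PreservesNCA f) {u v : S} :
    f u < f v ↔ u < v := by
  simp only [lt_iff_le_not_ge, hf.le_iff]

theorem PreservesNCA.comp {S T U : RootedTree} {g : T → U} {f : S → T} (hg : PreservesNCA g)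
    (hf : PreservesNCA f) : PreservesNCA (g ∘ f) :=
  ⟨hg.1.comp hf.1, fun u v => by simp only [Function.comp, hf.2, hg.2]⟩

/-- A universal tree may have nodes of degree one, so inner nodes are too weak to be counted;
branching is the property that images inherit. -/
theorem PreservesNCA.branching {S T : RootedTree} {f : S → T} (hf : PreservesNCA f) {v : S}
    (h : S.Branching v) : T.Branching (f v) := by
  obtain ⟨x, y, hx, hy, hxy⟩ := h
  exact ⟨f x, f y, hf.lt_iff.2 hx, hf.lt_iff.2 hy, by rw [← hf.2, hxy]⟩

/-! ### Grafting a leaf above a node -/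

/-- The nodes of the tree obtained by subdividing the edge above `v` by a new node `mid`, with a new
leaf `leaf` attached to it. -/
inductive GraftNode {α : Type} (v : α) : Type
  | old (u : α) : GraftNode v
  | mid : GraftNode v
  | leaf : GraftNode v

namespace GraftNode

variable {α : Type} {v : α}

instance [Finite α] : Finite (GraftNode v) :=
  Finite.of_surjective
    (fun x : α ⊕ Bool => match x with
      | .inl u => (.old u : GraftNode v)
      | .inr true => .mid
      | .inr false => .leaf) (by
    rintro (u | _ | _)
    exacts [⟨.inl u, rfl⟩, ⟨.inr true, rfl⟩, ⟨.inr false, rfl⟩])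

theorem old_injective : Function.Injective (old : α → GraftNode v) := fun _ _ h => by
  injection h

variable [PartialOrder α]

/-- The ancestor relation after grafting. -/
protected def le : GraftNode v → GraftNode v → Prop
  | old u, old w => u ≤ w
  | old u, mid => u < v
  | old u, leaf => u < v
  | mid, old w => v ≤ w
  | mid, mid => True
  | mid, leaf => True
  | leaf, leaf => True
  | leaf, _ => False

instance : PartialOrder (GraftNode v) where
  le := GraftNode.le
  le_refl := by
    rintro (u | _ | _) <;> simp [GraftNode.le]
  le_trans := by
    rintro (a | _ | _) (b | _ | _) (c | _ | _) <;> simp only [GraftNode.le, imp_self, implies_true,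
      false_imp_iff, true_imp_iff] <;> intros <;> order
  le_antisymm := by
    rintro (a | _ | _) (b | _ | _) <;> simp only [GraftNode.le, imp_self, implies_true,
      false_imp_iff, true_imp_iff, old.injEq] <;> intros <;> order

@[simp] theorem old_le_old {u w : α} : (old u : GraftNode v) ≤ old w ↔ u ≤ w := Iff.rfl
@[simp] theorem old_le_mid {u : α} : (old u : GraftNode v) ≤ mid ↔ u < v := Iff.rfl
@[simp] theorem old_le_leaf {u : α} : (old u : GraftNode v) ≤ leaf ↔ u < v := Iff.rfl
@[simp] theorem mid_le_old {u : α} : (mid : GraftNode v) ≤ old u ↔ v ≤ u := Iff.rfl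
@[simp] theorem mid_le_leaf : (mid : GraftNode v) ≤ leaf := trivial
@[simp] theorem not_leaf_le_old {u : α} : ¬ (leaf : GraftNode v) ≤ old u := id
@[simp] theorem not_leaf_le_mid : ¬ (leaf : GraftNode v) ≤ mid := id

@[simp] theorem old_lt_old {u w : α} : (old u : GraftNode v) < old w ↔ u < w := by
  simp only [lt_iff_le_not_ge, old_le_old]

@[simp] theorem old_lt_mid {u : α} : (old u : GraftNode v) < mid ↔ u < v := by
  simp only [lt_iff_le_not_ge (a := (old u : GraftNode v)), old_le_mid, mid_le_old,
    and_iff_left_iff_imp]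
  exact fun h => h.not_ge

@[simp] theorem old_lt_leaf {u : α} : (old u : GraftNode v) < leaf ↔ u < v := by
  simp [lt_iff_le_not_ge (a := (old u : GraftNode v))]

@[simp] theorem mid_lt_old {u : α} : (mid : GraftNode v) < old u ↔ v ≤ u := by
  simp only [lt_iff_le_not_ge (a := (mid : GraftNode v)), old_le_mid, mid_le_old,
    and_iff_left_iff_imp]
  exact fun h => h.not_gt

@[simp] theorem mid_lt_leaf : (mid : GraftNode v) < leaf := by
  simp [lt_iff_le_not_ge (a := (mid : GraftNode v))]

@[simp] theorem not_leaf_lt {x : GraftNode v} : ¬ leaf < x := by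
  rcases x with u | _ | _ <;> simp [lt_iff_le_not_ge (a := (leaf : GraftNode v))]

instance [OrderBot α] [DecidableEq α] : OrderBot (GraftNode v) where
  bot := if v = ⊥ then mid else old ⊥
  bot_le := by
    intro x
    split_ifs with h
    · subst h
      rcases x with u | _ | _ <;> simp
    · rcases x with u | _ | _ <;> simp [bot_lt_iff_ne_bot, h]

theorem chain (h : ∀ a b c : α, a ≤ c → b ≤ c → a ≤ b ∨ b ≤ a) (a b c : GraftNode v) :
    a ≤ c → b ≤ c → a ≤ b ∨ b ≤ a := by
  -- Ancestors of a descendant of `v` either belong to the subtree of `v` or are proper ancestors of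
  -- `v`, which decides their comparison with `mid`.
  have h1 : ∀ a c : α, v ≤ c → a ≤ c → v ≤ a ∨ a < v := fun a c hv ha => by
    rcases h v a c hv ha with h | h
    · exact .inl h
    · exact h.eq_or_lt.elim (fun h => .inl h.ge) .inr
  rcases a with a | _ | _ <;> rcases b with b | _ | _ <;> rcases c with c | _ | _ <;>
    simp only [old_le_old, old_le_mid, old_le_leaf, mid_le_old, mid_le_leaf, not_leaf_le_old,
      not_leaf_le_mid, le_refl, false_imp_iff, true_imp_iff, imp_true_iff, or_true, or_false, false_or,
      imp_self]
  · exact h a b c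
  · exact fun ha hb => h a b v ha.le hb.le
  · exact fun ha hb => h a b v ha.le hb.le
  · exact fun ha hb => (h1 a _ hb ha).symm
  · exact fun ha => .inl ha
  · exact fun ha => .inl ha
  · exact fun hb ha => h1 _ _ hb ha
  · exact fun hb => .inr hb
  · exact fun hb => .inr hb

end GraftNode

open Classical in
/-- The tree obtained from `S` by subdividing the edge above `v` (or adding a new root, if `v` is
the root) and attaching a new leaf to the new node. -/
noncomputable def graft (S : RootedTree.{0}) [Finite S] (v : S) : RootedTree.{0} :=
  ofFinite (GraftNode v) (GraftNode.chain fun _ _ _ => le_total_of_le)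

/-- The copy of a node of `S` in `S.graft v`. -/
def graftOld {S : RootedTree.{0}} [Finite S] (v : S) (u : S) : S.graft v :=
  (GraftNode.old u : GraftNode v)

/-- The new inner node of `S.graft v`. -/
def graftMid {S : RootedTree.{0}} [Finite S] (v : S) : S.graft v :=
  (GraftNode.mid : GraftNode v)

/-- The new leaf of `S.graft v`. -/
def graftLeaf {S : RootedTree.{0}} [Finite S] (v : S) : S.graft v :=
  (GraftNode.leaf : GraftNode v)

section graft

variable {S : RootedTree.{0}} [Finite S] {v u w : S}

instance : Finite (S.graft v) := inferInstanceAs (Finite (GraftNode v))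

theorem graft_cases (x : S.graft v) :
    (∃ u, x = graftOld v u) ∨ x = graftMid v ∨ x = graftLeaf v := by
  rcases (x : GraftNode v) with u | _ | _
  exacts [.inl ⟨u, rfl⟩, .inr (.inl rfl), .inr (.inr rfl)]

theorem graftOld_injective : Function.Injective (graftOld v) := GraftNode.old_injective

theorem graftOld_ne_graftMid : graftOld v u ≠ graftMid v := fun h => by
  have h : (GraftNode.old u : GraftNode v) = GraftNode.mid := h
  cases h

theorem graftOld_ne_graftLeaf : graftOld v u ≠ graftLeaf v := fun h => by
  have h : (GraftNode.old u : GraftNode v) = GraftNode.leaf := h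
  cases h

theorem graftMid_ne_graftLeaf : graftMid v ≠ graftLeaf v := fun h => by
  have h : (GraftNode.mid : GraftNode v) = GraftNode.leaf := h
  cases h

theorem graftOld_le_graftOld : graftOld v u ≤ graftOld v w ↔ u ≤ w := Iff.rfl
theorem graftOld_le_graftMid : graftOld v u ≤ graftMid v ↔ u < v := Iff.rfl
theorem graftMid_le_graftOld : graftMid v ≤ graftOld v u ↔ v ≤ u := Iff.rfl
theorem graftOld_lt_graftOld : graftOld v u < graftOld v w ↔ u < w := GraftNode.old_lt_old
theorem graftOld_lt_graftMid : graftOld v u < graftMid v ↔ u < v := GraftNode.old_lt_mid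
theorem graftOld_lt_graftLeaf : graftOld v u < graftLeaf v ↔ u < v := GraftNode.old_lt_leaf
theorem graftMid_lt_graftOld : graftMid v < graftOld v u ↔ v ≤ u := GraftNode.mid_lt_old
theorem graftMid_lt_graftLeaf : graftMid v < graftLeaf v := GraftNode.mid_lt_leaf
theorem not_graftLeaf_lt {x : S.graft v} : ¬ graftLeaf v < x := GraftNode.not_leaf_lt

theorem not_graftLeaf_le_graftOld : ¬ graftLeaf v ≤ graftOld v u := GraftNode.not_leaf_le_old

/-- The new inner node is never the infimum of two old nodes: if it lies below both, then so does
the larger node `graftOld v v`. -/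
theorem preservesNCA_graftOld : PreservesNCA (graftOld v) := by
  refine ⟨graftOld_injective, fun a b => ?_⟩
  refine le_antisymm (le_inf (graftOld_le_graftOld.2 inf_le_left)
    (graftOld_le_graftOld.2 inf_le_right)) ?_
  have h1 : graftOld v a ⊓ graftOld v b ≤ graftOld v a := inf_le_left
  have h2 : graftOld v a ⊓ graftOld v b ≤ graftOld v b := inf_le_right
  rcases graft_cases (graftOld v a ⊓ graftOld v b) with ⟨u, h⟩ | h | h <;> rw [h] at h1 h2 ⊢
  · exact graftOld_le_graftOld.2 (le_inf h1 h2)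
  · exact graftMid_le_graftOld.2 (le_inf h1 h2)
  · exact absurd h1 not_graftLeaf_le_graftOld

open Classical in
theorem graftOld_covBy {x : S.graft v} :
    graftOld v u ⋖ x ↔ ∃ w, u ⋖ w ∧ x = if w = v then graftMid v else graftOld v w := by
  constructor
  · intro h
    rcases graft_cases x with ⟨w, rfl⟩ | rfl | rfl
    · refine ⟨w, ⟨graftOld_lt_graftOld.1 h.1, fun y h1 h2 =>
        h.2 (graftOld_lt_graftOld.2 h1) (graftOld_lt_graftOld.2 h2)⟩, ?_⟩
      rw [if_neg]
      rintro rfl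
      exact h.2 (graftOld_lt_graftMid.2 (graftOld_lt_graftOld.1 h.1))
        (graftMid_lt_graftOld.2 le_rfl)
    · exact ⟨v, ⟨graftOld_lt_graftMid.1 h.1, fun y h1 h2 =>
        h.2 (graftOld_lt_graftOld.2 h1) (graftOld_lt_graftMid.2 h2)⟩, by rw [if_pos rfl]⟩
    · exact (h.2 (graftOld_lt_graftMid.2 (graftOld_lt_graftLeaf.1 h.1))
        graftMid_lt_graftLeaf).elim
  · rintro ⟨w, hw, rfl⟩
    split_ifs with hwv
    · subst hwv
      refine ⟨graftOld_lt_graftMid.2 hw.1, fun y h1 h2 => ?_⟩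
      rcases graft_cases y with ⟨y, rfl⟩ | rfl | rfl
      · exact hw.2 (graftOld_lt_graftOld.1 h1) (graftOld_lt_graftMid.1 h2)
      · exact lt_irrefl _ h2
      · exact not_graftLeaf_lt h2
    · refine ⟨graftOld_lt_graftOld.2 hw.1, fun y h1 h2 => ?_⟩
      rcases graft_cases y with ⟨y, rfl⟩ | rfl | rfl
      · exact hw.2 (graftOld_lt_graftOld.1 h1) (graftOld_lt_graftOld.1 h2)
      · exact hw.2 (graftOld_lt_graftMid.1 h1)
          (lt_of_le_of_ne (graftMid_lt_graftOld.1 h2) (Ne.symm hwv))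
      · exact not_graftLeaf_lt h2

theorem graftMid_covBy {x : S.graft v} :
    graftMid v ⋖ x ↔ x = graftOld v v ∨ x = graftLeaf v := by
  constructor
  · intro h
    rcases graft_cases x with ⟨w, rfl⟩ | rfl | rfl
    · rcases (graftMid_lt_graftOld.1 h.1).eq_or_lt with rfl | hlt
      · exact .inl rfl
      · exact (h.2 (graftMid_lt_graftOld.2 le_rfl) (graftOld_lt_graftOld.2 hlt)).elim
    · exact (lt_irrefl _ h.1).elim
    · exact .inr rfl
  · rintro (rfl | rfl)
    · refine ⟨graftMid_lt_graftOld.2 le_rfl, fun y h1 h2 => ?_⟩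
      rcases graft_cases y with ⟨y, rfl⟩ | rfl | rfl
      · exact (graftMid_lt_graftOld.1 h1).not_gt (graftOld_lt_graftOld.1 h2)
      · exact lt_irrefl _ h1
      · exact not_graftLeaf_lt h2
    · refine ⟨graftMid_lt_graftLeaf, fun y h1 h2 => ?_⟩
      rcases graft_cases y with ⟨y, rfl⟩ | rfl | rfl
      · exact (graftMid_lt_graftOld.1 h1).not_gt (graftOld_lt_graftLeaf.1 h2)
      · exact lt_irrefl _ h1
      · exact not_graftLeaf_lt h2

theorem not_graftLeaf_covBy {x : S.graft v} : ¬ graftLeaf v ⋖ x := fun h => not_graftLeaf_lt h.1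

theorem degree_graftOld : (S.graft v).degree (graftOld v u) = S.degree u := by
  classical
  have hinj : Function.Injective fun w => if w = v then graftMid v else graftOld v w := by
    intro a b h
    dsimp only at h
    split_ifs at h with ha hb hb
    · rw [ha, hb]
    · exact (graftOld_ne_graftMid h.symm).elim
    · exact (graftOld_ne_graftMid h).elim
    · exact graftOld_injective h
  rw [degree, degree, ← Set.ncard_image_of_injective _ hinj]
  congr 1
  ext x
  simp only [Set.mem_ofPred_eq, graftOld_covBy, Set.mem_image, eq_comm (a := x)]

theorem degree_graftMid : (S.graft v).degree (graftMid v) = 2 := by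
  have : {x | graftMid v ⋖ x} = {graftOld v v, graftLeaf v} := by
    ext x
    exact graftMid_covBy
  rw [degree, this, Set.ncard_pair graftOld_ne_graftLeaf]

theorem degree_graftLeaf : (S.graft v).degree (graftLeaf v) = 0 := by
  simp [degree, not_graftLeaf_covBy]

theorem isLeaf_graftOld : (S.graft v).IsLeaf (graftOld v u) ↔ S.IsLeaf u := by
  constructor
  · exact fun h w hw => h _ (graftOld_covBy.2 ⟨w, hw, rfl⟩)
  · intro h x hx
    obtain ⟨w, hw, -⟩ := graftOld_covBy.1 hx
    exact h w hw

theorem not_isLeaf_graftMid : ¬ (S.graft v).IsLeaf (graftMid v) :=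
  fun h => h _ (graftMid_covBy.2 (.inr rfl))

theorem isLeaf_graftLeaf : (S.graft v).IsLeaf (graftLeaf v) := fun _ => not_graftLeaf_covBy

theorem numLeaves_graft : (S.graft v).numLeaves = S.numLeaves + 1 := by
  have : {x | (S.graft v).IsLeaf x} = insert (graftLeaf v) (graftOld v '' {u | S.IsLeaf u}) := by
    ext x
    simp only [Set.mem_ofPred_eq, Set.mem_insert_iff, Set.mem_image]
    constructor
    · intro h
      rcases graft_cases x with ⟨w, rfl⟩ | rfl | rfl
      · exact .inr ⟨w, isLeaf_graftOld.1 h, rfl⟩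
      · exact (not_isLeaf_graftMid h).elim
      · exact .inl rfl
    · rintro (rfl | ⟨w, hw, rfl⟩)
      exacts [isLeaf_graftLeaf, isLeaf_graftOld.2 hw]
  rw [numLeaves, this, Set.ncard_insert_of_notMem, Set.ncard_image_of_injective _
    graftOld_injective,
    numLeaves]
  rintro ⟨w, -, h⟩
  exact graftOld_ne_graftLeaf h

theorem IsBinary.graft (h : S.IsBinary) : (S.graft v).IsBinary := by
  intro x
  rcases graft_cases x with ⟨w, rfl⟩ | rfl | rfl
  · exact degree_graftOld.trans_le (h w)
  · exact degree_graftMid.le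
  · exact degree_graftLeaf.trans_le (Nat.zero_le _)

theorem NoDegreeOne.graft (h : S.NoDegreeOne) : (S.graft v).NoDegreeOne := by
  intro x
  rcases graft_cases x with ⟨w, rfl⟩ | rfl | rfl
  · exact degree_graftOld.trans_ne (h w)
  · rw [degree_graftMid]; decide
  · rw [degree_graftLeaf]; decide

theorem depth_graftMid : (S.graft v).depth (graftMid v) = S.depth v := by
  have : Set.Iio (graftMid v) = graftOld v '' Set.Iio v := by
    ext x
    rcases graft_cases x with ⟨w, rfl⟩ | rfl | rfl
    · simp [graftOld_lt_graftMid, graftOld_injective.mem_set_image]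
    · simp [graftOld_ne_graftMid]
    · simp [not_graftLeaf_lt, graftOld_ne_graftLeaf]
  rw [depth, this, Set.ncard_image_of_injective _ graftOld_injective, depth]

theorem depth_graftOld_of_not_le (h : ¬ v ≤ u) :
    (S.graft v).depth (graftOld v u) = S.depth u := by
  have : Set.Iio (graftOld v u) = graftOld v '' Set.Iio u := by
    ext x
    rcases graft_cases x with ⟨w, rfl⟩ | rfl | rfl
    · simp [graftOld_lt_graftOld, graftOld_injective.mem_set_image]
    · simp [graftOld_ne_graftMid, graftMid_lt_graftOld, h]
    · simp [not_graftLeaf_lt, graftOld_ne_graftLeaf]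
  rw [depth, this, Set.ncard_image_of_injective _ graftOld_injective, depth]

/-- Grafting thus flips parities exactly in the subtree of `v`, which is the tool for meeting parity
constraints. -/
theorem depth_graftOld_of_le (h : v ≤ u) :
    (S.graft v).depth (graftOld v u) = S.depth u + 1 := by
  have : Set.Iio (graftOld v u) = insert (graftMid v) (graftOld v '' Set.Iio u) := by
    ext x
    rcases graft_cases x with ⟨w, rfl⟩ | rfl | rfl
    · simp [graftOld_lt_graftOld, graftOld_injective.mem_set_image, graftOld_ne_graftMid]
    · simp [graftMid_lt_graftOld, h]
    · simp [not_graftLeaf_lt, graftOld_ne_graftLeaf, graftMid_ne_graftLeaf.symm]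
  rw [depth, this, Set.ncard_insert_of_notMem, Set.ncard_image_of_injective _ graftOld_injective,
    depth]
  rintro ⟨w, -, h⟩
  exact graftOld_ne_graftMid h

end graft

/-! ### Pulling embeddings back along cuttings and contractions -/

theorem depth_eq_of_covBy {T : RootedTree} [Finite T] {a b : T} (h : a ⋖ b) :
    T.depth b = T.depth a + 1 := by
  have : Set.Iio b = insert a (Set.Iio a) := by
    ext x
    simp only [Set.mem_Iio, Set.mem_insert_iff]
    rw [← le_iff_eq_or_lt]
    refine ⟨fun hx => ?_, fun hx => hx.trans_lt h.lt⟩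
    exact (le_total_of_le hx.le h.le).elim id fun h' =>
      (h'.eq_or_lt.elim Eq.ge fun h'' => (h.2 h'' hx).elim)
  rw [depth, this, Set.ncard_insert_of_notMem (by simp), depth]

theorem IsBinary.eq_or_eq {T : RootedTree} [Finite T] (hT : T.IsBinary) {v x y z : T}
    (hx : v ⋖ x) (hy : v ⋖ y) (hz : v ⋖ z) (hxy : x ≠ y) : z = x ∨ z = y := by
  by_contra! h
  refine (hT v).not_gt ((Set.two_lt_ncard_iff (Set.toFinite _)).2
    ⟨x, y, z, hx, hy, hz, hxy, h.1.symm, h.2.symm⟩)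

/-- What survives a cutting is a lower set, whose inclusion keeps infima and depths. -/
theorem Cutting.pullback {S X Y : RootedTree.{0}} (h : Cutting X Y) {g : S → Y}
    (hg : PreservesNCA g) :
    ∃ f : S → X, PreservesNCA f ∧ ∀ v, X.depth (f v) % 2 = Y.depth (g v) % 2 := by
  obtain ⟨a, b, -, ⟨φ⟩⟩ := h
  obtain ⟨h1, h2⟩ := preservesNCA_of_lower (S := Y) (T := X) (f := fun y => (φ y).1)
    (Subtype.val_injective.comp φ.injective) (fun u v huv => φ.monotone huv) fun u l hl => by
      refine ⟨φ.symm ⟨l, fun hal => (φ u).2 (hal.trans hl)⟩, ?_, by simp⟩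
      rw [φ.symm_apply_le]
      exact hl
  exact ⟨_, h1.comp hg, fun v => by rw [Function.comp, h2]⟩

theorem le_parent_of_le {X : RootedTree} {a b c : X} (hab : a ⋖ b) (hbc : b ⋖ c) {x : X} (h : x ≤ c)
    (hb : x ≠ b)
    (hc : x ≠ c) : x ≤ a := by
  have h1 : ∀ {p q : X}, p ⋖ q → x ≤ q → x ≠ q → x ≤ p := fun hpq hx hne =>
    (le_total_of_le hx hpq.le).elim id fun h' =>
      h'.eq_or_lt.elim Eq.ge fun h'' => (hpq.2 h'' (lt_of_le_of_ne hx hne)).elim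
  exact h1 hab (h1 hbc h hc) hb

section contraction

variable {S X Y : RootedTree.{0}} [Finite X] {a b c : X}

theorem le_of_le_of_only_child (hbc : ∀ x : X, b ⋖ x ↔ x = c) {x : X} (h : b < x) : c ≤ x := by
  obtain ⟨y, hy, hyx⟩ := exists_covBy_le_of_lt h
  rwa [← (hbc y).1 hy]

/-- Reinserting `b` and `c` can spoil an infimum only where two images branch at `c`, since in `Y`
they branch at `a`. The node of `S` sent to `a` is then moved to `c`. This is consistent because `S`
is binary: the two children involved are its only ones, so everything below it already lies below
`c`. Every depth changes by 0 or 2. -/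
theorem contraction_inner_pullback [Finite S] (hS : S.IsBinary) (hab : a ⋖ b)
    (hbc : ∀ x : X, b ⋖ x ↔ x = c) (φ : Y ≃o {x : X // x ≠ b ∧ x ≠ c}) {g : S → Y}
    (hg : PreservesNCA g) :
    ∃ f : S → X, PreservesNCA f ∧ ∀ v, X.depth (f v) % 2 = Y.depth (g v) % 2 := by
  classical
  have hbc' : b ⋖ c := (hbc c).2 rfl
  set G : S → X := fun v => (φ (g v)).1 with hG
  have hGb : ∀ v, G v ≠ b := fun v => (φ (g v)).2.1
  have hGc : ∀ v, G v ≠ c := fun v => (φ (g v)).2.2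
  have hGle : ∀ {u v}, G u ≤ G v ↔ u ≤ v := fun {u v} =>
    (φ.le_iff_le (x := g u) (y := g v)).trans hg.le_iff
  have hGinj : ∀ {u v}, G u = G v → u = v := fun h =>
    le_antisymm (hGle.1 h.le) (hGle.1 h.ge)
  -- Lower bounds that survive the contraction are compared inside `Y`, where `g` preserves infima;
  -- only `b` and `c` need extra care.
  have hglb : ∀ {x u v}, x ≠ b → x ≠ c → x ≤ G u → x ≤ G v → x ≤ G (u ⊓ v) := by
    intro x u v h1 h2 hu hv
    have h3 : φ.symm ⟨x, h1, h2⟩ ≤ g (u ⊓ v) := by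
      rw [hg.2]
      exact le_inf (φ.symm_apply_le.2 hu) (φ.symm_apply_le.2 hv)
    exact φ.symm_apply_le.1 h3
  have ha : a ≠ b ∧ a ≠ c := ⟨hab.lt.ne, (hab.lt.trans hbc'.lt).ne⟩
  have hbG : ∀ {v}, b ≤ G v → c ≤ G v := fun h =>
    le_of_le_of_only_child hbc (lt_of_le_of_ne h (hGb _).symm)
  -- The condition for being moved from `a` to `c`.
  set C : S → Prop := fun v => G v = a ∧ (∃ w, v < w) ∧ ∀ w, v < w → c ≤ G w with hC
  set f : S → X := fun v => if C v then c else G v with hf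
  have hfC : ∀ {v}, C v → f v = c := fun h => if_pos h
  have hfG : ∀ {v}, ¬ C v → f v = G v := fun h => if_neg h
  have hGf : ∀ v, G v ≤ f v := by
    intro v
    by_cases h : C v
    · rw [hfC h, h.1]
      exact hab.le.trans hbc'.le
    · rw [hfG h]
  have hmono : ∀ {u v}, u ≤ v → f u ≤ f v := by
    intro u v huv
    rcases huv.eq_or_lt with rfl | hlt
    · exact le_rfl
    by_cases h : C u
    · rw [hfC h]
      exact (h.2.2 v hlt).trans (hGf v)
    · rw [hfG h]
      exact (hGle.2 huv).trans (hGf v)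
  have hinj : Function.Injective f := by
    intro u v h
    by_cases hu : C u <;> by_cases hv : C v
    · exact hGinj (hu.1.trans hv.1.symm)
    · rw [hfC hu, hfG hv] at h
      exact (hGc _ h.symm).elim
    · rw [hfG hu, hfC hv] at h
      exact (hGc _ h).elim
    · rw [hfG hu, hfG hv] at h
      exact hGinj h
  -- If `u` is moved and `v` is not a descendant of `u`, then `G v` lies outside the subtree of `a`,
  -- so the move creates no new common lower bound.
  have hkey : ∀ {u v}, C u → ¬ u ≤ v → ∀ {z}, z ≤ f u → z ≤ f v → z ≤ f (u ⊓ v) := by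
    intro u v hu huv z hzu hzv
    have hav : ¬ a ≤ G v := fun h => huv (hGle.1 (hu.1 ▸ h))
    have hv : ¬ C v := fun h => hav h.1.ge
    rw [hfC hu] at hzu
    rw [hfG hv] at hzv
    have hza : z ≤ a := by
      refine le_parent_of_le hab hbc' hzu ?_ ?_ <;> rintro rfl
      · exact hav (hab.le.trans hzv)
      · exact hav ((hab.le.trans hbc'.le).trans hzv)
    refine (hglb ?_ ?_ (hza.trans hu.1.ge) hzv).trans (hGf _)
    · exact (hza.trans_lt hab.lt).ne
    · exact ((hza.trans_lt hab.lt).trans hbc'.lt).ne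
  refine ⟨f, ⟨hinj, fun u v => le_antisymm (le_inf (hmono inf_le_left) (hmono inf_le_right)) ?_⟩,
    ?_⟩
  · by_cases huv : u ≤ v
    · rw [inf_eq_left.2 huv]
      exact inf_le_left
    by_cases hvu : v ≤ u
    · rw [inf_eq_right.2 hvu]
      exact inf_le_right
    by_cases hu : C u
    · exact hkey hu huv inf_le_left inf_le_right
    by_cases hv : C v
    · rw [inf_comm u v]
      exact hkey hv hvu inf_le_right inf_le_left
    rw [hfG hu, hfG hv]
    -- This is the one case in which the contraction changed the infimum: `u ⊓ v` was sent to `a`,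
    -- and it has to be shown that it is moved to `c`.
    by_cases hzc : G u ⊓ G v = c
    · have hcu : c ≤ G u := hzc.ge.trans inf_le_left
      have hcv : c ≤ G v := hzc.ge.trans inf_le_right
      have hac : a ≤ c := hab.le.trans hbc'.le
      have hw : G (u ⊓ v) = a := by
        refine le_antisymm (le_parent_of_le hab hbc' ?_ (hGb _) (hGc _))
          (hglb ha.1 ha.2 (hac.trans hcu) (hac.trans hcv))
        rw [← hzc]
        exact le_inf (hGle.2 inf_le_left) (hGle.2 inf_le_right)
      have hwu : u ⊓ v < u := inf_lt_left.2 huv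
      have hwv : u ⊓ v < v := inf_lt_right.2 hvu
      have hchild : ∀ {x y}, u ⊓ v ⋖ x → x ≤ y → c ≤ G y → c ≤ G x := by
        intro x y hx hxy hcy
        refine (le_total_of_le (hGle.2 hxy) hcy).elim (fun h => ?_) id
        have := le_parent_of_le hab hbc' h (hGb _) (hGc _)
        rw [← hw] at this
        exact (hx.lt.not_ge (hGle.1 this)).elim
      obtain ⟨x, hx, hxu⟩ := exists_covBy_le_of_lt hwu
      obtain ⟨y, hy, hyv⟩ := exists_covBy_le_of_lt hwv
      have hne : x ≠ y := by
        rintro rfl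
        exact hx.lt.not_ge (le_inf hxu hyv)
      rw [hzc, hfC]
      refine ⟨hw, ⟨u, hwu⟩, fun t ht => ?_⟩
      obtain ⟨z, hz, hzt⟩ := exists_covBy_le_of_lt ht
      refine le_trans ?_ (hGle.2 hzt)
      rcases hS.eq_or_eq hx hy hz hne with rfl | rfl
      · exact hchild hx hxu hcu
      · exact hchild hy hyv hcv
    -- The infimum cannot be `b`, because two images below `b` are also below its only child `c`.
    · refine (hglb (fun h => ?_) hzc inf_le_left inf_le_right).trans (hGf _)
      have : c ≤ G u ⊓ G v := le_inf (hbG (h.ge.trans inf_le_left)) (hbG (h.ge.trans inf_le_right))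
      exact hbc'.lt.not_ge (this.trans h.le)
  · have hinjφ : Function.Injective fun y : Y => (φ y).1 :=
      Subtype.val_injective.comp φ.injective
    have himg : ∀ v x, x ∈ (fun y : Y => (φ y).1) '' Set.Iio (g v) ↔ x ≠ b ∧ x ≠ c ∧ x < G v := by
      intro v x
      constructor
      · rintro ⟨y, hy, rfl⟩
        exact ⟨(φ y).2.1, (φ y).2.2, φ.lt_iff_lt.2 hy⟩
      · rintro ⟨h1, h2, h3⟩
        refine ⟨φ.symm ⟨x, h1, h2⟩, ?_, by simp⟩
        rw [Set.mem_Iio, ← φ.lt_iff_lt, φ.apply_symm_apply]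
        exact h3
    have hdG : ∀ v, X.depth (G v) % 2 = Y.depth (g v) % 2 := by
      intro v
      by_cases hb : b < G v
      · have hc : c < G v :=
          lt_of_le_of_ne (le_of_le_of_only_child hbc hb) (hGc _).symm
        have : Set.Iio (G v) = insert b (insert c ((fun y : Y => (φ y).1) '' Set.Iio (g v))) := by
          ext x
          simp only [Set.mem_insert_iff, himg, Set.mem_Iio]
          constructor
          · intro hx
            tauto
          · rintro (rfl | rfl | h)
            exacts [hb, hc, h.2.2]
        rw [depth, this, Set.ncard_insert_of_notMem, Set.ncard_insert_of_notMem,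
          Set.ncard_image_of_injective _ hinjφ, depth, add_assoc, Nat.add_mod_right]
        · simp [himg]
        · simp [himg, hbc'.lt.ne]
      · have : Set.Iio (G v) = (fun y : Y => (φ y).1) '' Set.Iio (g v) := by
          ext x
          rw [himg, Set.mem_Iio]
          refine ⟨fun hx => ⟨?_, ?_, hx⟩, fun h => h.2.2⟩ <;> rintro rfl
          · exact hb hx
          · exact hb (hbc'.lt.trans hx)
        rw [depth, this, Set.ncard_image_of_injective _ hinjφ, depth]
    intro v
    rw [← hdG]
    by_cases hv : C v
    · rw [hfC hv, hv.1, depth_eq_of_covBy hbc', depth_eq_of_covBy hab, add_assoc,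
        Nat.add_mod_right]
    · rw [hfG hv]

/-- The leaf `c` has in `Y` the depth that `b` has in `X`. A node sent to `c` is therefore
redirected to `b`, and all depths are kept. -/
theorem contraction_leaf_pullback (hab : a ⋖ b) (hbc : ∀ x : X, b ⋖ x ↔ x = c)
    (hc : X.IsLeaf c) (φ : Y ≃o {x : X // x ≠ b}) {g : S → Y} (hg : PreservesNCA g) :
    ∃ f : S → X, PreservesNCA f ∧ ∀ v, X.depth (f v) % 2 = Y.depth (g v) % 2 := by
  classical
  rw [isLeaf_iff] at hc
  have hbc' : b ⋖ c := (hbc c).2 rfl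
  set G : S → X := fun v => (φ (g v)).1 with hG
  have hGb : ∀ v, G v ≠ b := fun v => (φ (g v)).2
  have hGle : ∀ {u v}, G u ≤ G v ↔ u ≤ v := fun {u v} =>
    (φ.le_iff_le (x := g u) (y := g v)).trans hg.le_iff
  have hGinj : ∀ {u v}, G u = G v → u = v := fun h =>
    le_antisymm (hGle.1 h.le) (hGle.1 h.ge)
  have hglb : ∀ {x u v}, x ≠ b → x ≤ G u → x ≤ G v → x ≤ G (u ⊓ v) := by
    intro x u v h1 hu hv
    have h3 : φ.symm ⟨x, h1⟩ ≤ g (u ⊓ v) := by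
      rw [hg.2]
      exact le_inf (φ.symm_apply_le.2 hu) (φ.symm_apply_le.2 hv)
    exact φ.symm_apply_le.1 h3
  have hbG : ∀ {v}, b ≤ G v → G v = c := fun h =>
    hc _ (le_of_le_of_only_child hbc (lt_of_le_of_ne h (hGb _).symm))
  set f : S → X := fun v => if G v = c then b else G v with hf
  have hfC : ∀ {v}, G v = c → f v = b := fun h => if_pos h
  have hfG : ∀ {v}, G v ≠ c → f v = G v := fun h => if_neg h
  have hfle : ∀ v, f v ≤ G v := by
    intro v
    by_cases h : G v = c
    · rw [hfC h, h]
      exact hbc'.le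
    · rw [hfG h]
  have hmono : ∀ {u v}, u ≤ v → f u ≤ f v := by
    intro u v huv
    rcases huv.eq_or_lt with rfl | hlt
    · exact le_rfl
    have hu : G u ≠ c := fun h => hlt.ne (hGinj (h.trans (hc _ (h ▸ hGle.2 huv)).symm))
    rw [hfG hu]
    by_cases h : G v = c
    · rw [hfC h]
      exact (le_parent_of_le hab hbc' (h ▸ hGle.2 huv) (hGb _) hu).trans hab.le
    · rw [hfG h]
      exact hGle.2 huv
  have hinj : Function.Injective f := by
    intro u v h
    by_cases hu : G u = c <;> by_cases hv : G v = c
    · exact hGinj (hu.trans hv.symm)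
    · rw [hfC hu, hfG hv] at h
      exact (hGb _ h.symm).elim
    · rw [hfG hu, hfC hv] at h
      exact (hGb _ h).elim
    · rw [hfG hu, hfG hv] at h
      exact hGinj h
  refine ⟨f, ⟨hinj, fun u v => le_antisymm (le_inf (hmono inf_le_left) (hmono inf_le_right)) ?_⟩,
    fun v => ?_⟩
  · by_cases huv : u = v
    · rw [huv, inf_idem, inf_idem]
    have h1 : f u ⊓ f v ≤ G u := inf_le_left.trans (hfle u)
    have h2 : f u ⊓ f v ≤ G v := inf_le_right.trans (hfle v)
    have h3 : f u ⊓ f v ≠ b := fun h =>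
      huv (hGinj ((hbG (h ▸ h1)).trans (hbG (h ▸ h2)).symm))
    rw [hfG (v := u ⊓ v)]
    · exact hglb h3 h1 h2
    · intro h
      exact huv (hGinj ((hc _ (h ▸ hGle.2 (inf_le_left : u ⊓ v ≤ u))).trans
        (hc _ (h ▸ hGle.2 (inf_le_right : u ⊓ v ≤ v))).symm))
  · have hinjφ : Function.Injective fun y : Y => (φ y).1 :=
      Subtype.val_injective.comp φ.injective
    have himg : Set.Iio (f v) = (fun y : Y => (φ y).1) '' Set.Iio (g v) := by
      ext x
      have : x ∈ (fun y : Y => (φ y).1) '' Set.Iio (g v) ↔ x ≠ b ∧ x < G v := by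
        constructor
        · rintro ⟨y, hy, rfl⟩
          exact ⟨(φ y).2, φ.lt_iff_lt.2 hy⟩
        · rintro ⟨h1, h3⟩
          refine ⟨φ.symm ⟨x, h1⟩, ?_, by simp⟩
          rw [Set.mem_Iio, ← φ.lt_iff_lt, φ.apply_symm_apply]
          exact h3
      rw [this, Set.mem_Iio]
      by_cases hv : G v = c
      · rw [hfC hv, hv]
        exact ⟨fun h => ⟨h.ne, h.trans hbc'.lt⟩, fun h =>
          (le_parent_of_le hab hbc' h.2.le h.1 h.2.ne).trans_lt hab.lt⟩
      · rw [hfG hv]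
        refine ⟨fun h => ⟨?_, h⟩, fun h => h.2⟩
        rintro rfl
        exact hv (hbG h.le)
    rw [depth, himg, Set.ncard_image_of_injective _ hinjφ, depth]

theorem Contraction.pullback [Finite S] (hS : S.IsBinary) (h : Contraction X Y) {g : S → Y}
    (hg : PreservesNCA g) :
    ∃ f : S → X, PreservesNCA f ∧ ∀ v, X.depth (f v) % 2 = Y.depth (g v) % 2 := by
  obtain ⟨a, b, c, hab, hbc, ⟨-, ⟨φ⟩⟩ | ⟨hc, ⟨φ⟩⟩⟩ := h
  · exact contraction_inner_pullback hS hab hbc φ hg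
  · exact contraction_leaf_pullback hab hbc hc φ hg

end contraction

theorem finite_of_step {X Y : RootedTree.{0}} [Finite X] (h : Cutting X Y ∨ Contraction X Y) :
    Finite Y := by
  obtain ⟨a, b, -, ⟨φ⟩⟩ | ⟨a, b, c, -, -, ⟨-, ⟨φ⟩⟩ | ⟨-, ⟨φ⟩⟩⟩ := h <;>
    exact Finite.of_equiv _ φ.symm.toEquiv

/-- A tree that implements a binary tree contains it, with the same parities of the depths. -/
theorem Implements.exists_preservesNCA {T S : RootedTree.{0}} [Finite T] [Finite S]
    (hS : S.IsBinary) (h : Implements T S) :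
    ∃ f : S → T, PreservesNCA f ∧ ∀ v, T.depth (f v) % 2 = S.depth v % 2 := by
  obtain ⟨S', hTS, ⟨φ⟩⟩ := h
  have hT : Finite T := inferInstance
  -- The embedding into the last tree is pulled back one operation at a time towards `T`; finiteness
  -- has to be passed along to the intermediate trees.
  revert hT
  induction hTS using Relation.ReflTransGen.head_induction_on with
  | refl =>
    intro _
    obtain ⟨h1, h2⟩ := preservesNCA_of_lower (f := φ.symm) φ.symm.injective
      (fun u v huv => φ.symm.monotone huv) fun u l hl => ⟨φ l, φ.le_symm_apply.1 hl, by simp⟩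
    exact ⟨φ.symm, h1, fun v => by rw [h2]⟩
  | head hstep _ ih =>
    intro _
    have := finite_of_step hstep
    obtain ⟨g, hg, hd⟩ := ih this
    obtain ⟨f, hf, hd'⟩ := hstep.elim (fun h => h.pullback hg) fun h => h.pullback hS hg
    exact ⟨f, hf, fun v => (hd' v).trans (hd v)⟩

theorem IsYoungUniversal.isParityPreservingUniversal {n : ℕ} {T : RootedTree.{0}} [Finite T]
    (hT : T.IsYoungUniversal n) : T.IsParityPreservingUniversal (binaryTrees n) := by
  rintro S ⟨hfin, hbin, hdeg, hn⟩
  exact (hT S hfin hdeg hn.le).exists_preservesNCA hbin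

/-! ### Prescribing the parities of the inner nodes -/

/-- The function on `S.graft v` that extends `c` by the value `k` at the new nodes. -/
def graftExtend {S : RootedTree.{0}} [Finite S] (v : S) (c : S → ℕ) (k : ℕ) : S.graft v → ℕ :=
  fun x => match (x : GraftNode v) with
    | .old u => c u
    | _ => k

theorem graftExtend_old {S : RootedTree.{0}} [Finite S] {v u : S} {c : S → ℕ} {k : ℕ} :
    graftExtend v c k (graftOld v u) = c u := rfl

theorem graftExtend_mid {S : RootedTree.{0}} [Finite S] {v : S} {c : S → ℕ} {k : ℕ} :
    graftExtend v c k (graftMid v) = k := rfl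

theorem NoDegreeOne.ncard_inner_lt {S : RootedTree} [Finite S] (h : S.NoDegreeOne) :
    S.inner.ncard + 1 ≤ S.numLeaves :=
  (Nat.add_le_add_right (Set.ncard_le_ncard (fun _ hv => h.branching hv) (Set.toFinite _)) 1).trans
    (ncard_branching_lt S)

/-- By grafting a leaf for each of at most `k` inner nodes, a binary tree can be embedded into a
binary tree in such a way that the depths of its inner nodes get prescribed parities. -/
theorem exists_preservesNCA_depth (k : ℕ) : ∀ (S : RootedTree.{0}) (c : S → ℕ), Finite S →
    S.IsBinary → S.NoDegreeOne →
    {v ∈ S.inner | ∃ u ≤ v, S.depth u % 2 ≠ c u % 2}.ncard ≤ k →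
    ∃ (S' : RootedTree.{0}) (f : S → S'), Finite S' ∧ S'.IsBinary ∧ S'.NoDegreeOne ∧
      S'.numLeaves ≤ S.numLeaves + k ∧ PreservesNCA f ∧
      ∀ v ∈ S.inner, S'.depth (f v) % 2 = c v % 2 := by
  induction k with
  | zero =>
    intro S c hfin hbin hdeg hk
    refine ⟨S, id, hfin, hbin, hdeg, le_rfl, ⟨Function.injective_id, fun _ _ => rfl⟩,
      fun v hv => ?_⟩
    by_contra hne
    have : v ∈ (∅ : Set S) := by
      rw [← (Set.ncard_eq_zero (Set.toFinite _)).1 (Nat.le_zero.1 hk)]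
      exact ⟨hv, v, le_rfl, hne⟩
    exact this
  | succ k ih =>
    intro S c hfin hbin hdeg hk
    by_cases hM : {v ∈ S.inner | S.depth v % 2 ≠ c v % 2}.Nonempty
    swap
    · refine ⟨S, id, hfin, hbin, hdeg, Nat.le_add_right _ _,
        ⟨Function.injective_id, fun _ _ => rfl⟩, fun v hv => ?_⟩
      by_contra hne
      exact hM ⟨v, hv, hne⟩
    -- A topmost node of wrong parity: one graft above it repairs it, and no proper ancestor needs
    -- repair.
    obtain ⟨v, hv⟩ := (Set.toFinite _).exists_minimal hM
    have hvmin : ∀ w < v, S.depth w % 2 = c w % 2 := by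
      intro w hw
      by_contra hne
      exact hv.not_lt ⟨mem_inner_iff.2 ⟨v, hw⟩, hne⟩ hw
    have hvbad := hv.prop.2
    -- The new node is asked for the depth it already has, so it never counts as wrong.
    set c' := graftExtend v c (S.depth v) with hc'
    -- The measure counts inner nodes with a wrong weak ancestor. The flip may turn correct nodes
    -- below `v` into wrong ones, but these were counted already because of `v`; `v` itself drops
    -- out.
    have hsub : {x ∈ (S.graft v).inner | ∃ y ≤ x, (S.graft v).depth y % 2 ≠ c' y % 2} ⊆
        graftOld v '' ({v ∈ S.inner | ∃ u ≤ v, S.depth u % 2 ≠ c u % 2} \ {v}) := by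
      rintro x ⟨hx, y, hyx, hy⟩
      rcases graft_cases y with ⟨w, rfl⟩ | rfl | rfl
      · rw [hc', graftExtend_old] at hy
        by_cases hvw : v ≤ w
        · rw [depth_graftOld_of_le hvw] at hy
          have hvw' : v < w := lt_of_le_of_ne hvw (by rintro rfl; omega)
          rcases graft_cases x with ⟨u, rfl⟩ | rfl | rfl
          · refine ⟨u, ⟨⟨fun h => hx (isLeaf_graftOld.2 h), v, ?_, hvbad⟩, ?_⟩, rfl⟩
            · exact hvw.trans (graftOld_le_graftOld.1 hyx)
            · exact (hvw'.trans_le (graftOld_le_graftOld.1 hyx)).ne'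
          · exact absurd (graftOld_le_graftMid.1 hyx) hvw.not_gt
          · exact (hx isLeaf_graftLeaf).elim
        · rw [depth_graftOld_of_not_le hvw] at hy
          rcases graft_cases x with ⟨u, rfl⟩ | rfl | rfl
          · have hwu := graftOld_le_graftOld.1 hyx
            refine ⟨u, ⟨⟨fun h => hx (isLeaf_graftOld.2 h), w, hwu, hy⟩, ?_⟩, rfl⟩
            rintro rfl
            exact hy (hvmin w (lt_of_le_not_ge hwu hvw))
          · exact (hy (hvmin w (graftOld_le_graftMid.1 hyx))).elim
          · exact (hx isLeaf_graftLeaf).elim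
      · rw [depth_graftMid] at hy
        exact (hy rfl).elim
      · rcases hyx.eq_or_lt with rfl | h
        · exact (hx isLeaf_graftLeaf).elim
        · exact (not_graftLeaf_lt h).elim
    have hcard : {x ∈ (S.graft v).inner |
        ∃ y ≤ x, (S.graft v).depth y % 2 ≠ c' y % 2}.ncard ≤ k := by
      refine (Set.ncard_le_ncard hsub (Set.toFinite _)).trans ?_
      rw [Set.ncard_image_of_injective _ graftOld_injective]
      have := Set.ncard_sdiff_singleton_add_one
        (show v ∈ {v ∈ S.inner | ∃ u ≤ v, S.depth u % 2 ≠ c u % 2} from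
          ⟨hv.prop.1, v, le_rfl, hvbad⟩) (Set.toFinite _)
      omega
    obtain ⟨S', f, h1, h2, h3, h4, h5, h6⟩ :=
      ih (S.graft v) c' inferInstance hbin.graft hdeg.graft hcard
    refine ⟨S', f ∘ graftOld v, h1, h2, h3, ?_, h5.comp preservesNCA_graftOld, fun u hu => ?_⟩
    · rw [numLeaves_graft] at h4
      omega
    · exact h6 _ fun h => hu (isLeaf_graftOld.1 h)

/-- There are at most `n - 1` inner nodes, so at most `n - 1` leaves are grafted onto the given `n`.
-/
theorem exists_preservesNCA_depth_of_mem {n : ℕ} {S : RootedTree.{0}} (hS : S ∈ binaryTrees n)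
    (c : S.inner → Fin 2) :
    ∃ (S' : RootedTree.{0}) (f : S → S'), Finite S' ∧ S'.IsBinary ∧ S'.NoDegreeOne ∧
      S'.numLeaves ≤ 2 * n - 1 ∧ PreservesNCA f ∧
      ∀ v : S.inner, S'.depth (f v) % 2 = (c v : ℕ) := by
  classical
  obtain ⟨hfin, hbin, hdeg, hn⟩ := hS
  obtain ⟨S', f, h1, h2, h3, h4, h5, h6⟩ := exists_preservesNCA_depth S.inner.ncard S
    (fun v => if h : v ∈ S.inner then (c ⟨v, h⟩ : ℕ) else 0) hfin hbin hdeg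
    (Set.ncard_le_ncard (Set.sep_subset _ _) (Set.toFinite _))
  refine ⟨S', f, h1, h2, h3, ?_, h5, fun v => ?_⟩
  · have := hdeg.ncard_inner_lt
    omega
  · rw [h6 v v.2, dif_pos v.2, Nat.mod_eq_of_lt (c v).2]

theorem IsYoungUniversal.isParityConstrainedUniversal {n : ℕ} {T : RootedTree.{0}} [Finite T]
    (hT : T.IsYoungUniversal (2 * n - 1)) : T.IsParityConstrainedUniversal (binaryTrees n) := by
  intro S hS c
  obtain ⟨S', f, h1, h2, h3, h4, h5, h6⟩ := exists_preservesNCA_depth_of_mem hS c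
  obtain ⟨g, hg, hd⟩ := (hT S' h1 h3 h4).exists_preservesNCA h2
  exact ⟨g ∘ f, hg.comp h5, fun v => (hd _).trans (h6 v)⟩

/-! ### Existence of finite universal trees -/

/-- The lists without repetitions over `Fin N`, ordered by the prefix relation. -/
@[ext] structure NodupList (N : ℕ) where
  /-- The underlying list. -/
  toList : List (Fin N)
  nodup : toList.Nodup

namespace NodupList

variable {N : ℕ}

instance : Finite (NodupList N) :=
  Finite.of_injective (β := {l : List (Fin N) // l.Nodup}) (fun l => ⟨l.toList, l.nodup⟩)
    fun _ _ h => NodupList.ext (congrArg Subtype.val h)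

instance : PartialOrder (NodupList N) where
  le a b := a.toList <+: b.toList
  le_refl _ := List.prefix_rfl
  le_trans _ _ _ := List.IsPrefix.trans
  le_antisymm _ _ h h' := NodupList.ext (h.eq_of_length (le_antisymm h.length_le h'.length_le))

instance : OrderBot (NodupList N) where
  bot := ⟨[], List.nodup_nil⟩
  bot_le _ := List.nil_prefix

end NodupList

/-- The tree of lists without repetitions over `Fin N`. -/
noncomputable def listTree (N : ℕ) : RootedTree.{0} :=
  ofFinite (NodupList N) fun _ _ _ => List.prefix_or_prefix_of_prefix

instance (N : ℕ) : Finite (listTree N) := inferInstanceAs (Finite (NodupList N))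

theorem pred_lt_of_ne_bot {S : RootedTree} {v : S} (h : v ≠ ⊥) : Order.pred v < v :=
  Order.pred_lt_of_not_isMin fun hm => h hm.eq_bot

open Classical in
/-- The list of labels on the path from the root to `v`, without the label of the root. -/
noncomputable def path {S : RootedTree.{0}} [Finite S] {N : ℕ} (e : S ↪ Fin N) (v : S) :
    List (Fin N) :=
  if _ : v = ⊥ then [] else path e (Order.pred v) ++ [e v]
termination_by wellFounded_lt.wrap v
decreasing_by exact pred_lt_of_ne_bot ‹_›

section path

variable {S : RootedTree.{0}} [Finite S] {N : ℕ} (e : S ↪ Fin N)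

theorem path_bot : path e ⊥ = [] := by
  rw [path, dif_pos rfl]

theorem path_of_ne_bot {v : S} (h : v ≠ ⊥) : path e v = path e (Order.pred v) ++ [e v] := by
  rw [path, dif_neg h]

theorem mem_path {v : S} {x : Fin N} : x ∈ path e v → ∃ w ≤ v, e w = x := by
  induction v using WellFoundedLT.induction with
  | ind v ih =>
    by_cases h : v = ⊥
    · simp [h, path_bot]
    · rw [path_of_ne_bot e h, List.mem_append, List.mem_singleton]
      rintro (hx | rfl)
      · obtain ⟨w, hw, hx⟩ := ih _ (pred_lt_of_ne_bot h) hx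
        exact ⟨w, hw.trans (Order.pred_le v), hx⟩
      · exact ⟨v, le_rfl, rfl⟩

theorem nodup_path (v : S) : (path e v).Nodup := by
  induction v using WellFoundedLT.induction with
  | ind v ih =>
    by_cases h : v = ⊥
    · simp [h, path_bot]
    · rw [path_of_ne_bot e h, ← List.concat_eq_append]
      refine (ih _ (pred_lt_of_ne_bot h)).concat fun hmem => ?_
      obtain ⟨w, hw, hwv⟩ := mem_path e hmem
      exact (hw.trans_lt (pred_lt_of_ne_bot h)).ne (e.injective hwv)

theorem path_mono {u v : S} : u ≤ v → path e u <+: path e v := by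
  induction v using WellFoundedLT.induction with
  | ind v ih =>
    intro huv
    rcases huv.eq_or_lt with rfl | hlt
    · exact List.prefix_rfl
    have h : v ≠ ⊥ := (bot_le.trans_lt hlt).ne'
    rw [path_of_ne_bot e h]
    exact (ih _ (pred_lt_of_ne_bot h) (Order.le_pred_of_lt hlt)).trans (List.prefix_append _ _)

theorem exists_path_eq {v : S} {l : List (Fin N)} : l <+: path e v → ∃ w ≤ v, path e w = l := by
  induction v using WellFoundedLT.induction with
  | ind v ih =>
    by_cases h : v = ⊥
    · rw [h, path_bot, List.prefix_nil]
      rintro rfl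
      exact ⟨⊥, le_rfl, path_bot e⟩
    · intro hl
      rw [path_of_ne_bot e h, List.prefix_concat_iff] at hl
      rcases hl with rfl | hl
      · exact ⟨v, le_rfl, path_of_ne_bot e h⟩
      · obtain ⟨w, hw, hwl⟩ := ih _ (pred_lt_of_ne_bot h) hl
        exact ⟨w, hw.trans (Order.pred_le v), hwl⟩

theorem path_injective : Function.Injective (path e) := by
  intro u v h
  by_cases hu : u = ⊥ <;> by_cases hv : v = ⊥
  · rw [hu, hv]
  · rw [hu, path_bot, path_of_ne_bot e hv] at h
    simp at h
  · rw [hv, path_bot, path_of_ne_bot e hu] at h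
    simp at h
  · rw [path_of_ne_bot e hu, path_of_ne_bot e hv] at h
    exact e.injective (List.append_singleton_inj.1 h).2

end path

/-- Once nodes are labelled injectively, ancestors correspond to prefixes of label paths, and all
prefixes of a path occur as paths. -/
theorem exists_preservesNCA_listTree {S : RootedTree.{0}} [Finite S] {N : ℕ}
    (hN : Nat.card S ≤ N) :
    ∃ f : S → listTree N, PreservesNCA f ∧ ∀ v, (listTree N).depth (f v) = S.depth v := by
  obtain ⟨e⟩ : Nonempty (S ↪ Fin N) := by
    have := Fintype.ofFinite S
    rw [Nat.card_eq_fintype_card] at hN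
    exact Function.Embedding.nonempty_of_card_le (by simpa using hN)
  refine ⟨fun v => (⟨path e v, nodup_path e v⟩ : NodupList N), preservesNCA_of_lower ?_ ?_ ?_⟩
  · exact fun u v h => path_injective e (congrArg NodupList.toList h)
  · exact fun u v h => path_mono e h
  · intro u l hl
    obtain ⟨w, hw, h⟩ := exists_path_eq e (l := NodupList.toList l) hl
    exact ⟨w, hw, NodupList.ext h⟩

theorem isParityConstrainedUniversal_listTree (n : ℕ) :
    (listTree (4 * n)).IsParityConstrainedUniversal (binaryTrees n) := by
  intro S hS c
  obtain ⟨S', f, h1, h2, h3, h4, h5, h6⟩ := exists_preservesNCA_depth_of_mem hS c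
  -- At most `2 * n - 1` leaves and fewer inner nodes than leaves: `4 * n` labels suffice.
  obtain ⟨g, hg, hd⟩ := exists_preservesNCA_listTree (S := S') (N := 4 * n) (by
    have := numLeaves_add_ncard_inner S'
    have := h3.ncard_inner_lt
    omega)
  exact ⟨g ∘ f, hg.comp h5, fun v => by rw [Function.comp, hd, h6]⟩

/-- A finite universal tree must be exhibited, as `sInf` of the empty set would be the junk value 0.
-/
theorem exists_numLeaves_eq_minLeaves (n : ℕ) : ∃ T : RootedTree.{0},
    Finite T ∧ T.IsParityConstrainedUniversal (binaryTrees n) ∧ T.numLeaves = minLeaves n :=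
  Nat.sInf_mem (s := {k | ∃ T : RootedTree.{0},
    Finite T ∧ T.IsParityConstrainedUniversal (binaryTrees n) ∧ T.numLeaves = k})
    ⟨_, listTree (4 * n), inferInstance, isParityConstrainedUniversal_listTree n, rfl⟩

theorem minLeaves_le {n : ℕ} {T : RootedTree.{0}} [hfin : Finite T]
    (hT : T.IsParityConstrainedUniversal (binaryTrees n)) : minLeaves n ≤ T.numLeaves :=
  Nat.sInf_le ⟨T, hfin, hT, rfl⟩

/-! ### The recursive lower bound -/

/-- A lower set containing the root, as a tree. -/
noncomputable def lowerTree (T : RootedTree.{0}) [Finite T] (X : Set T) (hbot : ⊥ ∈ X) :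
    RootedTree.{0} :=
  letI : OrderBot X := { bot := ⟨⊥, hbot⟩, bot_le := fun _ => bot_le (α := T) }
  ofFinite X fun _ _ _ => le_total_of_le (T := T)

section lowerTree

variable {T : RootedTree.{0}} [Finite T] {X : Set T} {hbot : ⊥ ∈ X}

instance : Finite (T.lowerTree X hbot) := inferInstanceAs (Finite X)

/-- The inclusion of `T.lowerTree X` into `T`. -/
def lowerVal : T.lowerTree X hbot → T := fun x => (show X from x).1

theorem lowerVal_injective : Function.Injective (lowerVal : T.lowerTree X hbot → T) :=
  Subtype.val_injective

theorem preservesNCA_lowerVal (hX : IsLowerSet X) :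
    PreservesNCA (lowerVal : T.lowerTree X hbot → T) ∧
      ∀ v, T.depth (lowerVal v) = (T.lowerTree X hbot).depth v :=
  preservesNCA_of_lower lowerVal_injective (fun _ _ h => h) fun u l hl =>
    ⟨(⟨l, hX hl (show X from u).2⟩ : X), hl, rfl⟩

theorem numLeaves_lowerTree : (T.lowerTree X hbot).numLeaves = {v | Maximal (· ∈ X) v}.ncard := by
  rw [numLeaves, ← Set.ncard_image_of_injective _ (lowerVal_injective (hbot := hbot))]
  congr 1
  ext v
  simp only [isLeaf_iff, Set.mem_image, Set.mem_ofPred_eq]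
  constructor
  · rintro ⟨x, hx, rfl⟩
    refine ⟨(show X from x).2, fun w hw hxw => ?_⟩
    have := hx (⟨w, hw⟩ : X) hxw
    exact (congrArg lowerVal this).le
  · intro hv
    exact ⟨(⟨v, hv.prop⟩ : X), fun w hw =>
      lowerVal_injective (hv.eq_of_ge (show X from w).2 hw), rfl⟩

end lowerTree

/-! ### Subtrees cut out by chains of branching nodes -/

/-- The nodes `v` for which there are `k` branching nodes of depth congruent to `p` modulo two on
some path descending from `v`. -/
def chainSet (T : RootedTree.{0}) (p : ℕ) : ℕ → Set T
  | 0 => Set.univ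
  | k + 1 => {v | ∃ w ≥ v, T.Branching w ∧ T.depth w % 2 = p ∧ ∃ u > w, u ∈ T.chainSet p k}

section chainSet

variable {T : RootedTree.{0}} {p : ℕ}

theorem isLowerSet_chainSet (k : ℕ) : IsLowerSet (T.chainSet p k) := by
  cases k with
  | zero => exact isLowerSet_univ
  | succ k =>
    rintro a b hba ⟨w, hw, h⟩
    exact ⟨w, hba.trans hw, h⟩

theorem chainSet_antitone : Antitone (T.chainSet p) := by
  refine antitone_nat_of_succ_le fun k => ?_
  induction k with
  | zero => exact Set.subset_univ _
  | succ k ih =>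
    rintro v ⟨w, hw, hb, hp, u, hu, h⟩
    exact ⟨w, hw, hb, hp, u, hu, ih h⟩

/-- The first branching node of a chain descending from `v` is itself a member, so maximality puts
it at `v`. A longer chain would leave a member strictly below `v` in the tree. -/
theorem branching_of_maximal {k : ℕ} {v : T} (hv : Maximal (· ∈ T.chainSet p (k + 1)) v) :
    T.Branching v ∧ T.depth v % 2 = p ∧ v ∉ T.chainSet p (k + 2) := by
  obtain ⟨w, hw, h⟩ := hv.prop
  obtain rfl := hv.eq_of_ge (⟨w, le_rfl, h⟩ : w ∈ T.chainSet p (k + 1)) hw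
  refine ⟨h.1, h.2.1, ?_⟩
  rintro ⟨w', hw', -, -, u, hu, hmem⟩
  exact (hw'.trans_lt hu).not_ge (hv.le_of_ge hmem (hw'.trans_lt hu).le)

end chainSet

/-- A leaf has no descendants that could obstruct placing it at the new inner node, where its image
becomes branching. -/
theorem preservesNCA_graft_leaf {S : RootedTree.{0}} [Finite S] {a : S} (ha : S.IsLeaf a)
    {j : S → S.graft a} (hja : j a = graftMid a) (hj : ∀ v, v ≠ a → j v = graftOld a v) :
    PreservesNCA j := by
  have hlt : ∀ {u v}, u < v → u ≠ a := fun {u v} h hu => by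
    rw [hu] at h
    exact h.ne' (isLeaf_iff.1 ha v h.le)
  have hmono : ∀ {u v}, u ≤ v → j u ≤ j v := by
    intro u v huv
    rcases huv.eq_or_lt with rfl | h
    · exact le_rfl
    rw [hj u (hlt h)]
    by_cases hv : v = a
    · rw [hv, hja]
      exact graftOld_le_graftMid.2 (hv ▸ h)
    · rw [hj v hv]
      exact graftOld_le_graftOld.2 huv
  have hle : ∀ u, j u ≤ graftOld a u := by
    intro u
    by_cases hu : u = a
    · rw [hu, hja]
      exact graftMid_le_graftOld.2 le_rfl
    · rw [hj u hu]
  refine ⟨fun u v h => ?_, fun u v =>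
    le_antisymm (le_inf (hmono inf_le_left) (hmono inf_le_right)) ?_⟩
  · by_cases hu : u = a <;> by_cases hv : v = a
    · rw [hu, hv]
    · rw [hu, hja, hj v hv] at h
      exact (graftOld_ne_graftMid h.symm).elim
    · rw [hv, hja, hj u hu] at h
      exact (graftOld_ne_graftMid h).elim
    · rw [hj u hu, hj v hv] at h
      exact graftOld_injective h
  · by_cases huv : u ≤ v
    · rw [inf_eq_left.2 huv]
      exact inf_le_left
    rw [hj _ (hlt (inf_lt_left.2 huv)), preservesNCA_graftOld.2]
    exact inf_le_inf (hle u) (hle v)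

/-- In a parity-constrained universal tree, the leaves of a binary tree can be mapped to nodes that
have long chains of branching nodes of a given parity below them. -/
theorem IsParityConstrainedUniversal.exists_chainSet {n : ℕ} {T : RootedTree.{0}}
    (hT : T.IsParityConstrainedUniversal (binaryTrees n)) {p : ℕ} (hp : p < 2) (N : ℕ) :
    ∀ (S : RootedTree.{0}) [DecidableEq S] (c : S → ℕ) (L : Multiset S), Finite S → S.IsBinary →
      S.NoDegreeOne → Multiset.card L = N → S.numLeaves + N = n → (∀ v ∈ L, S.IsLeaf v) →
      ∃ f : S → T, PreservesNCA f ∧ (∀ v ∈ S.inner, T.depth (f v) % 2 = c v % 2) ∧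
        ∀ v, f v ∈ T.chainSet p (L.count v) := by
  classical
  induction N with
  | zero =>
    intro S _ c L hfin hbin hdeg hL hn _
    obtain ⟨f, hf, hc⟩ := hT S ⟨hfin, hbin, hdeg, hn⟩ fun v => ⟨c v % 2, Nat.mod_lt _ two_pos⟩
    refine ⟨f, hf, fun v hv => hc ⟨v, hv⟩, fun v => ?_⟩
    rw [Multiset.card_eq_zero.1 hL, Multiset.count_zero]
    trivial
  | succ N ih =>
    intro S _ c L hfin hbin hdeg hL hn hleaf
    -- Multiplicities in the multiset are the requested chain lengths; one unit of the request at
    -- `a` is traded for a leaf grafted above `a` with parity `p` at the new node.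
    obtain ⟨a, L, rfl⟩ : ∃ a M, L = a ::ₘ M := by
      have hpos : 0 < Multiset.card L := hL ▸ N.succ_pos
      obtain ⟨a, ha⟩ := Multiset.card_pos_iff_exists_mem.1 hpos
      exact ⟨a, Multiset.exists_cons_of_mem ha⟩
    have ha : S.IsLeaf a := hleaf a (Multiset.mem_cons_self a L)
    obtain ⟨f, hf, hc, hmem⟩ := ih (S.graft a) (graftExtend a c p) (L.map (graftOld a))
      inferInstance hbin.graft hdeg.graft (by simpa using hL)
      (by rw [numLeaves_graft]; omega) (by
        intro v hv
        obtain ⟨u, hu, rfl⟩ := Multiset.mem_map.1 hv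
        exact isLeaf_graftOld.2 (hleaf u (Multiset.mem_cons_of_mem hu)))
    set j : S → S.graft a := fun v => if v = a then graftMid a else graftOld a v with hj
    have hja : j a = graftMid a := if_pos rfl
    have hjne : ∀ v, v ≠ a → j v = graftOld a v := fun v hv => if_neg hv
    refine ⟨f ∘ j, hf.comp (preservesNCA_graft_leaf ha hja hjne), fun v hv => ?_, fun v => ?_⟩
    · have hva : v ≠ a := by
        rintro rfl
        exact hv ha
      rw [Function.comp, hjne v hva, hc _ fun h => hv (isLeaf_graftOld.1 h), graftExtend_old]
    · have hold : ∀ v, f (graftOld a v) ∈ T.chainSet p (L.count v) := fun v => by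
        have := hmem (graftOld a v)
        rwa [Multiset.count_map_eq_count' _ _ graftOld_injective] at this
      by_cases hva : v = a
      · subst hva
        rw [Function.comp, hja, Multiset.count_cons_self]
        have hbr : (S.graft v).Branching (graftMid v) :=
          hdeg.graft.branching not_isLeaf_graftMid
        -- The image of the new node heads the chain found for the old copy of the leaf, lengthening
        -- it by one.
        refine ⟨_, le_rfl, hf.branching hbr, ?_, _,
          hf.lt_iff.2 (graftMid_lt_graftOld.2 le_rfl), hold v⟩
        rw [hc _ not_isLeaf_graftMid, graftExtend_mid, Nat.mod_eq_of_lt hp]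
      · rw [Function.comp, hjne v hva, Multiset.count_cons_of_ne hva]
        exact hold v

theorem exists_isLeaf_ge {S : RootedTree} [Finite S] (v : S) : ∃ a, v ≤ a ∧ S.IsLeaf a := by
  obtain ⟨a, ha, hmax⟩ := Set.toFinite (Set.univ : Set S) |>.exists_le_maximal (Set.mem_univ v)
  exact ⟨a, ha, isLeaf_iff.2 fun w hw => hmax.eq_of_le trivial hw |>.symm⟩

theorem IsParityConstrainedUniversal.exists_mem_chainSet {n m s : ℕ} {T : RootedTree.{0}}
    (hT : T.IsParityConstrainedUniversal (binaryTrees n)) {p : ℕ} (hp : p < 2)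
    (hs : m * (s + 1) ≤ n) {S : RootedTree.{0}} (hS : S ∈ binaryTrees m) (c : S → ℕ) :
    ∃ f : S → T, PreservesNCA f ∧ (∀ v ∈ S.inner, T.depth (f v) % 2 = c v % 2) ∧
      ∀ v, f v ∈ T.chainSet p s := by
  classical
  obtain ⟨hfin, hbin, hdeg, hm⟩ := hS
  have := Fintype.ofFinite S
  obtain ⟨a, -, ha⟩ := exists_isLeaf_ge (⊥ : S)
  set A : Multiset S := (Finset.univ.filter fun v => S.IsLeaf v).val with hA
  have hAm : Multiset.card A = m := by
    rw [← hm, numLeaves, Set.ncard_eq_toFinset_card', hA, Finset.card_val]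
    congr 1
    ext
    simp
  have hleaf : ∀ v ∈ A, S.IsLeaf v := fun v hv => (Finset.mem_filter.1 hv).2
  obtain ⟨f, hf, hc, hmem⟩ := hT.exists_chainSet hp (n - m) S c
    -- Each leaf requests `s` branching nodes. The remainder goes to one arbitrary leaf, because
    -- `binaryTrees n` demands exactly `n` leaves.
    (s • A + Multiset.replicate (n - m * (s + 1)) a) hfin hbin hdeg
    (by
      rw [Multiset.card_add, Multiset.card_nsmul, Multiset.card_replicate, hAm]
      have : m * (s + 1) = s * m + m := by ring
      omega)
    (by
      have : m * (s + 1) = s * m + m := by ring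
      omega)
    (fun v hv => by
      rcases Multiset.mem_add.1 hv with hv | hv
      · exact hleaf v (Multiset.mem_of_mem_nsmul hv)
      · rwa [Multiset.eq_of_mem_replicate hv])
  refine ⟨f, hf, hc, fun v => ?_⟩
  obtain ⟨b, hvb, hb⟩ := exists_isLeaf_ge v
  refine isLowerSet_chainSet s (hf.le_iff.2 hvb) (chainSet_antitone ?_ (hmem b))
  rw [Multiset.count_add, Multiset.count_nsmul]
  have : Multiset.count b A = 1 :=
    Multiset.count_eq_one_of_mem (Finset.nodup _) (Finset.mem_filter.2 ⟨Finset.mem_univ _, hb⟩)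
  rw [this]
  omega

theorem binaryTrees_nonempty {m : ℕ} (hm : 1 ≤ m) : (binaryTrees m).Nonempty := by
  induction m, hm using Nat.le_induction with
  | base =>
    refine ⟨ofFinite Unit fun _ _ _ _ _ => .inl le_rfl, inferInstanceAs (Finite Unit), ?_⟩
    have hleaf : ∀ v w : ofFinite Unit fun _ _ _ _ _ => .inl le_rfl, ¬ v ⋖ w :=
      fun v w h => h.lt.ne rfl
    refine ⟨fun v => ?_, fun v => ?_, ?_⟩
    · simp [degree, hleaf]
    · simp [degree, hleaf]
    · exact Set.ncard_eq_one.2 ⟨⊥, Set.ext fun v => ⟨fun _ => rfl, fun _ => hleaf v⟩⟩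
  | succ m _ ih =>
    obtain ⟨S, hfin, hbin, hdeg, hm⟩ := ih
    exact ⟨S.graft ⊥, inferInstance, hbin.graft, hdeg.graft, by rw [numLeaves_graft, hm]⟩

/-- The lower set, viewed as a tree, is itself universal for `m` leaves, and its leaves are its
maximal elements. -/
theorem IsParityConstrainedUniversal.minLeaves_le_ncard {n m s : ℕ} {T : RootedTree.{0}} [Finite T]
    (hT : T.IsParityConstrainedUniversal (binaryTrees n)) {p : ℕ} (hp : p < 2) (hm : 1 ≤ m)
    (hs : m * (s + 1) ≤ n) : minLeaves m ≤ {v | Maximal (· ∈ T.chainSet p s) v}.ncard := by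
  have hbot : ⊥ ∈ T.chainSet p s := by
    obtain ⟨S, hS⟩ := binaryTrees_nonempty hm
    obtain ⟨f, -, -, hf⟩ := hT.exists_mem_chainSet hp hs hS fun _ => 0
    exact isLowerSet_chainSet s bot_le (hf ⊥)
  rw [← numLeaves_lowerTree (hbot := hbot)]
  refine minLeaves_le fun S hS c => ?_
  classical
  obtain ⟨f, hf, hc, hmem⟩ := hT.exists_mem_chainSet hp hs hS
    fun v => if h : v ∈ S.inner then (c ⟨v, h⟩ : ℕ) else 0
  obtain ⟨h1, h2⟩ := preservesNCA_lowerVal (hbot := hbot) (isLowerSet_chainSet s)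
  set g : S → T.lowerTree (T.chainSet p s) hbot :=
    fun v => (⟨f v, hmem v⟩ : T.chainSet p s) with hg
  have hgf : ∀ v, lowerVal (g v) = f v := fun v => rfl
  refine ⟨g, ⟨fun u v h => hf.1 (congrArg lowerVal h), fun u v => h1.1 ?_⟩, fun v => ?_⟩
  · rw [h1.2, hgf, hgf, hgf, hf.2]
  · rw [← h2, hgf, hc v v.2, dif_pos v.2, Nat.mod_eq_of_lt (c v).2]

/-- The recursive lower bound for the number of leaves of parity-constrained universal trees. -/
theorem one_add_two_mul_sum_le_minLeaves (n : ℕ) :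
    1 + 2 * ∑ s ∈ Finset.Icc 2 n, minLeaves (n / s) ≤ minLeaves n := by
  classical
  obtain ⟨T, hfin, hT, hn⟩ := exists_numLeaves_eq_minLeaves n
  have := Fintype.ofFinite T
  rw [← hn]
  refine le_trans ?_ (ncard_branching_lt T)
  rw [add_comm]
  refine Nat.add_le_add_right ?_ 1
  -- Chains of length `s - 1` account for caterpillars with `s` leaves; `2 ≤ s` makes the length
  -- positive, so that maximal elements branch.
  set D : ℕ × ℕ → Finset T := fun q =>
    Finset.univ.filter fun v => Maximal (· ∈ T.chainSet q.2 (q.1 - 1)) v with hD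
  have hDmem : ∀ {q v}, v ∈ D q → Maximal (· ∈ T.chainSet q.2 (q.1 - 1)) v :=
    fun h => (Finset.mem_filter.1 h).2
  set I := Finset.Icc 2 n ×ˢ Finset.range 2 with hI
  have hle : ∀ q ∈ I, minLeaves (n / q.1) ≤ (D q).card := by
    rintro ⟨s, p⟩ hq
    simp only [hI, Finset.mem_product, Finset.mem_Icc, Finset.mem_range] at hq
    have h := hT.minLeaves_le_ncard (m := n / s) (s := s - 1) hq.2
      (Nat.div_pos hq.1.2 (by omega))
      (by rw [Nat.sub_add_cancel (by omega)]; exact Nat.div_mul_le_self n s)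
    rwa [Set.ncard_eq_toFinset_card', Set.toFinset_ofPred] at h
  have hbr : ∀ q ∈ I, ∀ v ∈ D q, T.Branching v ∧ T.depth v % 2 = q.2 ∧
      v ∉ T.chainSet q.2 q.1 := by
    rintro ⟨s, p⟩ hq v hv
    simp only [hI, Finset.mem_product, Finset.mem_Icc, Finset.mem_range] at hq
    obtain ⟨k, rfl⟩ : ∃ k, s = k + 2 := ⟨s - 2, by omega⟩
    exact branching_of_maximal (hDmem hv)
  have hdisj : (I : Set (ℕ × ℕ)).PairwiseDisjoint D := by
    -- The parity of `v` fixes `p`, and the exact length of the longest chain from `v` fixes `s`.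
    have key : ∀ q ∈ I, ∀ q' ∈ I, ∀ v ∈ D q, v ∈ D q' → q.1 ≤ q'.1 := by
      intro q hq q' hq' v hv hv'
      by_contra! hlt
      refine (hbr q' hq' v hv').2.2 ?_
      rw [← (hbr q' hq' v hv').2.1, (hbr q hq v hv).2.1]
      exact chainSet_antitone (by omega) (hDmem hv).prop
    intro q hq q' hq' hne
    refine Finset.disjoint_left.2 fun v hv hv' => hne ?_
    refine Prod.ext (le_antisymm (key q hq q' hq' v hv hv') (key q' hq' q hq v hv' hv)) ?_
    rw [← (hbr q hq v hv).2.1, (hbr q' hq' v hv').2.1]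
  calc 2 * ∑ s ∈ Finset.Icc 2 n, minLeaves (n / s)
      = ∑ q ∈ I, minLeaves (n / q.1) := by
        rw [hI, Finset.sum_product]
        simp [Finset.mul_sum]
    _ ≤ ∑ q ∈ I, (D q).card := Finset.sum_le_sum hle
    _ = (I.biUnion D).card := (Finset.card_biUnion hdisj).symm
    _ ≤ (Finset.univ.filter fun v => T.Branching v).card := by
        refine Finset.card_le_card fun v hv => ?_
        obtain ⟨q, hq, hv⟩ := Finset.mem_biUnion.1 hv
        exact Finset.mem_filter.2 ⟨Finset.mem_univ _, (hbr q hq v hv).1⟩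
    _ = {v | T.Branching v}.ncard := by
        rw [Set.ncard_eq_toFinset_card', Set.toFinset_ofPred]

end RootedTree

/-! ### Estimates for the zeta function -/

theorem summable_one_div_add_one_rpow {c : ℝ} (hc : 1 < c) :
    Summable fun n : ℕ => 1 / ((n : ℝ) + 1) ^ c := by
  have := (summable_nat_add_iff 1).2 (Real.summable_one_div_nat_rpow.2 hc)
  simpa using this

theorem riemannZeta_ofReal_re {c : ℝ} (hc : 1 < c) :
    (riemannZeta (c : ℂ)).re = ∑' n : ℕ, 1 / ((n : ℝ) + 1) ^ c := by
  rw [zeta_eq_tsum_one_div_nat_add_one_cpow (by simpa using hc)]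
  have : (fun n : ℕ => 1 / ((n : ℂ) + 1) ^ (c : ℂ)) =
      fun n : ℕ => ((1 / ((n : ℝ) + 1) ^ c : ℝ) : ℂ) := by
    ext n
    push_cast [Complex.ofReal_cpow (show (0 : ℝ) ≤ (n : ℝ) + 1 by positivity)]
    rfl
  rw [this, ← Complex.ofReal_tsum, Complex.ofReal_re]

/-- A convexity estimate for negative powers: the trapezoidal rule overestimates the integral. -/
theorem rpow_sub_rpow_div_le {c x : ℝ} (hc : 1 < c) (hx : 0 < x) :
    (x ^ (1 - c) - (x + 1) ^ (1 - c)) / (c - 1) ≤ (x ^ (-c) + (x + 1) ^ (-c)) / 2 := by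
  -- The chord bound follows from weighted AM-GM, used once for the bases and once for their powers.
  have hsec : ∀ t ∈ Set.Icc (0 : ℝ) 1,
      (x + t) ^ (-c) ≤ (1 - t) * x ^ (-c) + t * (x + 1) ^ (-c) := by
    intro t ht
    have h1 : x ^ (1 - t) * (x + 1) ^ t ≤ x + t := by
      refine (Real.geom_mean_le_arith_mean2_weighted (sub_nonneg.2 ht.2) ht.1 hx.le
        (by positivity) (by ring)).trans_eq (by ring)
    have h2 := Real.geom_mean_le_arith_mean2_weighted (sub_nonneg.2 ht.2) ht.1
      (Real.rpow_nonneg hx.le (-c)) (Real.rpow_nonneg (by positivity : (0 : ℝ) ≤ x + 1) (-c))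
      (by ring)
    refine le_trans ?_ h2
    have h3 : (x ^ (-c)) ^ (1 - t) * ((x + 1) ^ (-c)) ^ t = (x ^ (1 - t) * (x + 1) ^ t) ^ (-c) := by
      rw [Real.mul_rpow (by positivity) (by positivity), ← Real.rpow_mul hx.le,
        ← Real.rpow_mul (by positivity), ← Real.rpow_mul hx.le, ← Real.rpow_mul (by positivity),
        mul_comm (-c), mul_comm (-c)]
    rw [h3]
    exact Real.rpow_le_rpow_of_nonpos (by positivity) h1 (by linarith)
  have hint : ∫ t in (0 : ℝ)..1, (x + t) ^ (-c) = (x ^ (1 - c) - (x + 1) ^ (1 - c)) / (c - 1) := by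
    rw [intervalIntegral.integral_comp_add_left (fun y => y ^ (-c)), integral_rpow]
    · rw [add_zero, show -c + 1 = -(c - 1) by ring, show 1 - c = -(c - 1) by ring, div_neg,
        ← neg_div, neg_sub]
    · refine .inr ⟨by linarith, ?_⟩
      rw [Set.uIcc_of_le (by linarith)]
      exact fun h => by linarith [h.1]
  have hint' : ∫ t in (0 : ℝ)..1, ((1 - t) * x ^ (-c) + t * (x + 1) ^ (-c)) =
      (x ^ (-c) + (x + 1) ^ (-c)) / 2 := by
    rw [intervalIntegral.integral_add (Continuous.intervalIntegrable (by fun_prop) _ _)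
      (Continuous.intervalIntegrable (by fun_prop) _ _), intervalIntegral.integral_mul_const,
      intervalIntegral.integral_mul_const, intervalIntegral.integral_sub
      (Continuous.intervalIntegrable (by fun_prop) _ _)
      (Continuous.intervalIntegrable (by fun_prop) _ _), integral_id]
    simp
    ring
  rw [← hint, ← hint']
  refine intervalIntegral.integral_mono_on zero_le_one ?_
    (Continuous.intervalIntegrable (by fun_prop) _ _) hsec
  refine ContinuousOn.intervalIntegrable fun t ht => ContinuousAt.continuousWithinAt ?_
  rw [Set.uIcc_of_le zero_le_one] at ht
  exact (continuousAt_const.add continuousAt_id).rpow_const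
    (.inl (add_pos_of_pos_of_nonneg hx ht.1).ne')

/-- The tail of the zeta series is bounded below by the trapezoidal rule. -/
theorem sum_add_tail_le_tsum {c : ℝ} (hc : 1 < c) (N : ℕ) :
    ∑ n ∈ Finset.range N, 1 / ((n : ℝ) + 1) ^ c +
      (((N : ℝ) + 1) ^ (1 - c) / (c - 1) + ((N : ℝ) + 1) ^ (-c) / 2) ≤
    ∑' n : ℕ, 1 / ((n : ℝ) + 1) ^ c := by
  -- Integral plus half the first term: the differences of `G` are bounded by the terms of the
  -- series, and `G` tends to 0, so the sums telescope.
  set G : ℕ → ℝ := fun n => ((n : ℝ) + 1) ^ (1 - c) / (c - 1) + ((n : ℝ) + 1) ^ (-c) / 2 with hG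
  have hstep : ∀ n : ℕ, G n - G (n + 1) ≤ 1 / ((n : ℝ) + 1) ^ c := by
    intro n
    have h := rpow_sub_rpow_div_le hc (by positivity : (0 : ℝ) < (n : ℝ) + 1)
    rw [sub_div] at h
    rw [one_div, ← Real.rpow_neg (by positivity)]
    simp only [hG]
    push_cast
    linarith
  have hsum : ∀ M, N ≤ M → ∑ n ∈ Finset.range N, 1 / ((n : ℝ) + 1) ^ c + (G N - G M) ≤
      ∑ n ∈ Finset.range M, 1 / ((n : ℝ) + 1) ^ c := by
    intro M hM
    induction M, hM using Nat.le_induction with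
    | base => simp
    | succ M _ ih =>
      rw [Finset.sum_range_succ]
      linarith [hstep M]
  have hcast : Tendsto (fun n : ℕ => (n : ℝ) + 1) atTop atTop :=
    tendsto_atTop_add_const_right _ _ tendsto_natCast_atTop_atTop
  have hG0 : Tendsto G atTop (nhds 0) := by
    have h1 := (tendsto_rpow_neg_atTop (sub_pos.2 hc)).comp hcast
    have h2 := (tendsto_rpow_neg_atTop (zero_lt_one.trans hc)).comp hcast
    simpa [hG, Function.comp_def] using (h1.div_const (c - 1)).add (h2.div_const 2)
  have hlim := (hG0.const_sub (G N)).const_add (∑ n ∈ Finset.range N, 1 / ((n : ℝ) + 1) ^ c)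
  rw [sub_zero] at hlim
  exact le_of_tendsto_of_tendsto hlim (summable_one_div_add_one_rpow hc).hasSum.tendsto_sum_nat
    ((eventually_ge_atTop N).mono hsum)

/-! ### Numerical evaluation at 2.185 -/

/-- Since 2.185 = 437/200, bounds on real powers become comparisons of rational numbers. -/
theorem rpow_le_of_pow_le {x : ℝ} {u : ℝ} (hx : 0 ≤ x) (hu : 0 ≤ u) (h : x ^ 437 ≤ u ^ 200) :
    x ^ (2.185 : ℝ) ≤ u := by
  refine le_of_pow_le_pow_left₀ (n := 200) (by norm_num) hu ?_
  rw [← Real.rpow_natCast, ← Real.rpow_mul hx]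
  refine le_trans (le_of_eq ?_) h
  rw [← Real.rpow_natCast x 437]
  norm_num

set_option exponentiation.threshold 500 in
theorem three_halves_lt_riemannZeta : 3 / 2 < (riemannZeta ((2.185 : ℝ) : ℂ)).re := by
  rw [riemannZeta_ofReal_re (by norm_num)]
  -- Twelve terms and the tail from 13 exceed 3/2 by only about 10^(-4), hence the four decimals in
  -- the bounds below.
  refine lt_of_lt_of_le ?_ (sum_add_tail_le_tsum (by norm_num) 12)
  have h2 := one_div_le_one_div_of_le (by positivity)
    (rpow_le_of_pow_le (x := 2) (u := 45473 / 10 ^ 4) (by norm_num) (by norm_num) (by norm_num))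
  have h3 := one_div_le_one_div_of_le (by positivity)
    (rpow_le_of_pow_le (x := 3) (u := 110284 / 10 ^ 4) (by norm_num) (by norm_num) (by norm_num))
  have h4 := one_div_le_one_div_of_le (by positivity)
    (rpow_le_of_pow_le (x := 4) (u := 206777 / 10 ^ 4) (by norm_num) (by norm_num) (by norm_num))
  have h5 := one_div_le_one_div_of_le (by positivity)
    (rpow_le_of_pow_le (x := 5) (u := 336705 / 10 ^ 4) (by norm_num) (by norm_num) (by norm_num))
  have h6 := one_div_le_one_div_of_le (by positivity)
    (rpow_le_of_pow_le (x := 6) (u := 501488 / 10 ^ 4) (by norm_num) (by norm_num) (by norm_num))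
  have h7 := one_div_le_one_div_of_le (by positivity)
    (rpow_le_of_pow_le (x := 7) (u := 702327 / 10 ^ 4) (by norm_num) (by norm_num) (by norm_num))
  have h8 := one_div_le_one_div_of_le (by positivity)
    (rpow_le_of_pow_le (x := 8) (u := 940268 / 10 ^ 4) (by norm_num) (by norm_num) (by norm_num))
  have h9 := one_div_le_one_div_of_le (by positivity)
    (rpow_le_of_pow_le (x := 9) (u := 1216242 / 10 ^ 4) (by norm_num) (by norm_num) (by norm_num))
  have h10 := one_div_le_one_div_of_le (by positivity)
    (rpow_le_of_pow_le (x := 10) (u := 1531088 / 10 ^ 4) (by norm_num) (by norm_num) (by norm_num))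
  have h11 := one_div_le_one_div_of_le (by positivity)
    (rpow_le_of_pow_le (x := 11) (u := 1885572 / 10 ^ 4) (by norm_num) (by norm_num) (by norm_num))
  have h12 := one_div_le_one_div_of_le (by positivity)
    (rpow_le_of_pow_le (x := 12) (u := 2280400 / 10 ^ 4) (by norm_num) (by norm_num) (by norm_num))
  have h13 := one_div_le_one_div_of_le (by positivity)
    (rpow_le_of_pow_le (x := 13) (u := 2716229 / 10 ^ 4) (by norm_num) (by norm_num) (by norm_num))
  simp only [Finset.sum_range_succ, Finset.sum_range_zero]
  have e : ((12 : ℕ) + 1 : ℝ) ^ (1 - 2.185 : ℝ) = 13 * (1 / (13 : ℝ) ^ (2.185 : ℝ)) := by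
    rw [Real.rpow_sub (by norm_num), Real.rpow_one, mul_one_div]
    norm_num
  have e' : ((12 : ℕ) + 1 : ℝ) ^ (-2.185 : ℝ) = 1 / (13 : ℝ) ^ (2.185 : ℝ) := by
    rw [Real.rpow_neg (by norm_num)]
    norm_num
  rw [e, e']
  norm_num [-one_div] at *
  linarith

/-! ### Polynomial growth from the recursion -/

namespace RootedTree

/-- The recursive lower bound forces growth with every exponent `c` such that `ζ(c) > 3 / 2`. -/
theorem exists_mul_rpow_le_minLeaves {c : ℝ} (hc : 1 < c)
    (hζ : 3 / 2 < (riemannZeta (c : ℂ)).re) :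
    ∃ ε : ℝ, 0 < ε ∧ ∀ n : ℕ, 1 ≤ n → ε * ((n : ℝ) + 1) ^ c ≤ minLeaves n := by
  rw [riemannZeta_ofReal_re hc] at hζ
  obtain ⟨N, hN⟩ := eventually_atTop.1
    ((summable_one_div_add_one_rpow hc).hasSum.tendsto_sum_nat.eventually (lt_mem_nhds hζ))
  have hsum : ∀ n : ℕ, 1 ≤ n → N ≤ n → 1 / 2 ≤ ∑ s ∈ Finset.Icc 2 n, 1 / (s : ℝ) ^ c := by
    intro n h1 hn
    have h := hN n hn
    have e : ∑ i ∈ Finset.range n, 1 / ((i : ℝ) + 1) ^ c =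
        1 + ∑ s ∈ Finset.Icc 2 n, 1 / (s : ℝ) ^ c := by
      have : ∑ i ∈ Finset.range n, 1 / ((i : ℝ) + 1) ^ c =
          ∑ s ∈ Finset.Ico 1 (n + 1), 1 / (s : ℝ) ^ c := by
        rw [Finset.sum_Ico_eq_sum_range]
        simp [add_comm]
      rw [this, Finset.sum_eq_sum_Ico_succ_bot (by omega)]
      simp only [Nat.cast_one, Real.one_rpow, div_one]
      rfl
    linarith
  -- With this constant the claimed bound is at most 1 for `n < N`, where `minLeaves n` is at least
  -- 1 by the recursion.
  refine ⟨1 / ((N : ℝ) + 1) ^ c, by positivity, fun n => ?_⟩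
  set ε : ℝ := 1 / ((N : ℝ) + 1) ^ c with hε
  have hε0 : 0 < ε := by positivity
  induction n using Nat.strong_induction_on with
  | _ n ih =>
    intro h1
    have hrec := one_add_two_mul_sum_le_minLeaves n
    rcases lt_or_ge n N with hn | hn
    · have hone : (1 : ℝ) ≤ minLeaves n := by exact_mod_cast (by omega : 1 ≤ minLeaves n)
      refine le_trans ?_ hone
      rw [hε, one_div, ← div_eq_inv_mul, div_le_one (by positivity)]
      gcongr
    · have hterm : ∀ s ∈ Finset.Icc 2 n,
          ε * ((n : ℝ) + 1) ^ c * (1 / (s : ℝ) ^ c) ≤ minLeaves (n / s) := by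
        intro s hs
        rw [Finset.mem_Icc] at hs
        have hs0 : (0 : ℝ) < s := by exact_mod_cast (by omega : 0 < s)
        refine le_trans ?_ (ih (n / s) (Nat.div_lt_self h1 hs.1) (Nat.div_pos hs.2 (by omega)))
        rw [mul_assoc, mul_one_div, ← Real.div_rpow (by positivity) hs0.le]
        -- The reason for using `n + 1` in the ansatz: it absorbs the rounding in `n / s`.
        have hle : ((n : ℝ) + 1) / s ≤ ((n / s : ℕ) : ℝ) + 1 := by
          rw [div_le_iff₀ hs0]
          have := Nat.lt_mul_div_succ n (by omega : 0 < s)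
          have h : n + 1 ≤ (n / s + 1) * s := by rw [mul_comm]; exact this
          exact_mod_cast h
        gcongr
      have h2 := Finset.sum_le_sum hterm
      rw [← Finset.mul_sum] at h2
      have h3 : (1 : ℝ) + 2 * ∑ s ∈ Finset.Icc 2 n, (minLeaves (n / s) : ℝ) ≤ minLeaves n := by
        exact_mod_cast hrec
      have h4 := mul_le_mul_of_nonneg_left (hsum n h1 hn)
        (by positivity : 0 ≤ ε * ((n : ℝ) + 1) ^ c)
      linarith

theorem isBigO_minLeaves {c : ℝ} (hc : 1 < c) (hζ : 3 / 2 < (riemannZeta (c : ℂ)).re) :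
    (fun n : ℕ => (n : ℝ) ^ c) =O[atTop] fun n : ℕ => (minLeaves n : ℝ) := by
  obtain ⟨ε, hε, h⟩ := exists_mul_rpow_le_minLeaves hc hζ
  refine IsBigO.of_bound (1 / ε) ((eventually_ge_atTop 1).mono fun n hn => ?_)
  rw [Real.norm_of_nonneg (by positivity), Real.norm_of_nonneg (by positivity), one_div,
    ← div_eq_inv_mul, le_div_iff₀' hε]
  refine le_trans ?_ (h n hn)
  gcongr
  linarith

/-- A lower bound on the size of trees that are universal in the sense of Young et al. -/
theorem exists_mul_rpow_le_numLeaves {c : ℝ} (hc : 1 < c)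
    (hζ : 3 / 2 < (riemannZeta (c : ℂ)).re) :
    ∃ a : ℝ, 0 < a ∧ ∀ n : ℕ, 1 ≤ n → ∀ T : RootedTree.{0}, Finite T → T.IsYoungUniversal n →
      a * (n : ℝ) ^ c ≤ T.numLeaves := by
  obtain ⟨ε, hε, h⟩ := exists_mul_rpow_le_minLeaves hc hζ
  refine ⟨ε / 2 ^ c, by positivity, fun n hn T hfin hT => ?_⟩
  -- `(n + 1) / 2` is the largest `m` with `2 * m - 1 ≤ n`.
  have hm : 1 ≤ (n + 1) / 2 := by omega
  have huniv : T.IsYoungUniversal (2 * ((n + 1) / 2) - 1) :=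
    fun S hS hdeg hle => hT S hS hdeg (hle.trans (by omega))
  have hle : minLeaves ((n + 1) / 2) ≤ T.numLeaves :=
    minLeaves_le huniv.isParityConstrainedUniversal
  refine le_trans ?_ ((h _ hm).trans (by exact_mod_cast hle))
  rw [div_mul_eq_mul_div, mul_div_assoc, ← Real.div_rpow (by positivity) (by norm_num)]
  have hhalf : (n : ℝ) / 2 ≤ (((n + 1) / 2 : ℕ) : ℝ) + 1 := by
    rw [div_le_iff₀ two_pos]
    exact_mod_cast (by omega : n ≤ ((n + 1) / 2 + 1) * 2)
  gcongr

end RootedTree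

theorem mainTheorem6 :
    (∀ (n : ℕ) (T : RootedTree.{0}), Finite T → T.IsYoungUniversal n →
      T.IsParityPreservingUniversal (RootedTree.binaryTrees n)) ∧
    (∀ (n : ℕ) (T : RootedTree.{0}), 1 ≤ n → Finite T → T.IsYoungUniversal (2 * n - 1) →
      T.IsParityConstrainedUniversal (RootedTree.binaryTrees n)) ∧
    (∀ n : ℕ, 1 ≤ n →
      1 + 2 * ∑ s ∈ Finset.Icc 2 n, RootedTree.minLeaves (n / s) ≤ RootedTree.minLeaves n) ∧
    (∀ c : ℝ, 1 < c → 3 / 2 < (riemannZeta (c : ℂ)).re →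
      (fun n : ℕ => (n : ℝ) ^ c) =O[atTop] fun n : ℕ => (RootedTree.minLeaves n : ℝ)) ∧
    3 / 2 < (riemannZeta ((2.185 : ℝ) : ℂ)).re ∧
    ((fun n : ℕ => (n : ℝ) ^ (2.185 : ℝ)) =O[atTop]
      fun n : ℕ => (RootedTree.minLeaves n : ℝ)) ∧
    (∃ a : ℝ, 0 < a ∧ ∀ᶠ n : ℕ in atTop, ∀ T : RootedTree.{0}, Finite T → T.IsYoungUniversal n →
      a * (n : ℝ) ^ (2.185 : ℝ) ≤ T.numLeaves ∧ a * (n : ℝ) ^ (2.185 : ℝ) ≤ Nat.card T) := by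
  obtain ⟨a, ha, h⟩ := RootedTree.exists_mul_rpow_le_numLeaves (by norm_num : (1 : ℝ) < 2.185)
    three_halves_lt_riemannZeta
  refine ⟨fun n T hfin hT => hT.isParityPreservingUniversal,
    fun n T hn hfin hT => hT.isParityConstrainedUniversal,
    fun n _ => RootedTree.one_add_two_mul_sum_le_minLeaves n,
    fun c hc hζ => RootedTree.isBigO_minLeaves hc hζ, three_halves_lt_riemannZeta,
    RootedTree.isBigO_minLeaves (by norm_num) three_halves_lt_riemannZeta,
    a, ha, (eventually_ge_atTop 1).mono fun n hn T hfin hT =>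
      ⟨h n hn T hfin hT, (h n hn T hfin hT).trans ?_⟩⟩
  exact_mod_cast (Nat.le_add_right _ _).trans_eq T.numLeaves_add_ncard_inner
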